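/- For $N\ge 4$ let $k_i=\begin{pmatrix}a_i&b_i\\c_i&d_i\end{pmatrix}$, $i=1,\dots,N$, be $2\times2$ matrices of independent variables, let $\mathbb{C}[k_1,\dots,k_N]$ be the polynomial ring in the $4N$ entries, and let $R_N=\mathbb{C}[k_1,\dots,k_N]/I_N$, where $I_N$ is the ideal generated by the four entries of $k_1+\dots+k_N$ and by $\det k_1,\dots,\det k_N$. A subset $J\subset\{1,\dots,N\}$ is called internal if $2\le|J|\le N-2$; put $Q_J=\det\big(\sum_{i\in J}k_i\big)\in R_N$, so that $Q_J=Q_{J^c}$, and $Q_{ij}=Q_{\{i,j\}}$. Let $\mathfrak{P}_N$ be the set of all prime ideals $\mathfrak p$ of $R_N$ for which there is an internal $J$ such that $\mathfrak p$ is a minimal prime over the principal ideal $(Q_J)$. All ideals below are ideals of $R_N$, and "maximal minors" are the $2\times2$ minors of matrices with two rows. **Theorem (Classification of prime divisors).** *(The case $N=4$.)* Let $\mathfrak p_{++++}$ be the ideal generated by the maximal minors of the $2\times8$ matrix $(k_1\,k_2\,k_3\,k_4)$, let $\mathfrak p_{----}$ be the ideal generated by the maximal minors of $(k_1^T\,k_2^T\,k_3^T\,k_4^T)$,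 and for each two-element subset $S=\{i,j\}$ of $\{1,2,3,4\}$ with complement $\{l,m\}$ let $\mathfrak p_S$ be the ideal generated by the maximal minors of the two $2\times4$ matrices $(k_i\,k_j)$ and $(k_l^T\,k_m^T)$ (so $\mathfrak p_{\{1,2\}}=\mathfrak p_{++--}$, and the other $\mathfrak p_S$ are its permutations). Then $\mathfrak P_4$ has exactly $8$ elements, namely $\mathfrak p_{++++}$, $\mathfrak p_{----}$ and the six ideals $\mathfrak p_S$. Each of $\mathfrak p_{++++}$ and $\mathfrak p_{----}$ is minimal over all three ideals $(Q_{12})=(Q_{34})$, $(Q_{13})=(Q_{24})$, $(Q_{14})=(Q_{23})$. For every two-element $S$ one has $(Q_S)=(Q_{S^c})$, and for internal $J$ the ideal $\mathfrak p_S$ is a minimal prime over $(Q_J)$ if and only if $J=S$ or $J=S^c$. The zero locus of $\mathfrak p_{++++}$ in $(\mathbb{C}^{2\times2})^4$ is the set of all points of the form $k_i=vw_i^T$ with $v,w_1,\dots,w_4\in\mathbb{C}^2$ and $w_1+w_2+w_3+w_4=0$. *(The case $N\ge5$.)* Every $\mathfrak p\in\mathfrak P_N$ lies over (that is, contains) exactly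 one of the ideals $(Q_J)$ with $J$ internal, and the internal set $J$ is determined by $\mathfrak p$ up to replacing $J$ by $J^c$. Moreover: - If $J$ and $J^c$ both have at least three elements, then $(Q_J)$ is itself a prime ideal. - For $i\neq j$ there are exactly two minimal primes over $(Q_{ij})$, namely the two distinct ideals $\mathfrak p_{ij}^+$ and $\mathfrak p_{ij}^-$ generated by the maximal minors of $(k_i\,k_j)$ and of $(k_i^T\,k_j^T)$ respectively. -/

import Mathlib

noncomputable section

namespace MomentaVariety

/-- The polynomial ring `ℂ[k_1, …, k_N]` in `4 N` variables; the variable `(i, r, c)` is the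
entry in row `r` and column `c` of the `2 × 2` matrix `k_i`. -/
abbrev PolyRing (N : ℕ) : Type := MvPolynomial (Fin N × Fin 2 × Fin 2) ℂ

/-- The generic `2 × 2` matrix `k_i`, over the polynomial ring. -/
def polyMomentum {N : ℕ} (i : Fin N) : Matrix (Fin 2) (Fin 2) (PolyRing N) :=
  Matrix.of fun r c => MvPolynomial.X (i, r, c)

/-- `I_N = (k_1 + ⋯ + k_N, det k_1, …, det k_N)`: generated by the four entries of the matrix
`k_1 + ⋯ + k_N` and by the `N` determinants. -/
def momentaIdeal (N : ℕ) : Ideal (PolyRing N) :=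
  Ideal.span
    ((Set.range fun rc : Fin 2 × Fin 2 => (∑ i : Fin N, polyMomentum i) rc.1 rc.2) ∪
      Set.range fun i : Fin N => (polyMomentum i).det)

/-- The ring `R_N = ℂ[k_1, …, k_N] / I_N`. -/
abbrev MomentaRing (N : ℕ) : Type := PolyRing N ⧸ momentaIdeal N

/-- The `2 × 2` matrix `k_i` over `R_N`. -/
def momentum {N : ℕ} (i : Fin N) : Matrix (Fin 2) (Fin 2) (MomentaRing N) :=
  (polyMomentum i).map (Ideal.Quotient.mk (momentaIdeal N))

/-- An internal momentum: a subset `J ⊆ {1, …, N}` with `2 ≤ |J| ≤ N - 2`. -/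
def IsInternal {N : ℕ} (J : Finset (Fin N)) : Prop :=
  2 ≤ J.card ∧ J.card + 2 ≤ N

/-- `Q_J = det k_J` in `R_N`, where `k_J = ∑_{i ∈ J} k_i`. -/
def Q {N : ℕ} (J : Finset (Fin N)) : MomentaRing N :=
  (∑ i ∈ J, momentum i).det

/-- The principal ideal `(Q_J)` of `R_N`. -/
def idealQ {N : ℕ} (J : Finset (Fin N)) : Ideal (MomentaRing N) :=
  Ideal.span {Q J}

/-- The set `𝔓_N` of prime divisors: all ideals of `R_N` that are a minimal prime over `(Q_J)`
for some internal `J`. -/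
def primeDivisors (N : ℕ) : Set (Ideal (MomentaRing N)) :=
  {p | ∃ J : Finset (Fin N), IsInternal J ∧ p ∈ (idealQ J).minimalPrimes}

/-- The maximal minors of a matrix with two rows: the determinants of the submatrices formed by
two distinct columns (in either order, which only affects the sign). -/
def maximalMinors {A n : Type*} [CommRing A] (M : Matrix (Fin 2) n A) : Set A :=
  Set.range fun e : Fin 2 ↪ n => (M.submatrix id e).det

/-- The `2 × 2|S|` matrix `(k_i)_{i ∈ S}` formed by placing the `k_i` side by side. -/
def rowPlus {N : ℕ} (S : Finset (Fin N)) : Matrix (Fin 2) (S × Fin 2) (MomentaRing N) :=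
  Matrix.of fun r ic => momentum (ic.1 : Fin N) r ic.2

/-- The `2 × 2|S|` matrix `(k_iᵀ)_{i ∈ S}` formed by placing the transposes side by side. -/
def rowMinus {N : ℕ} (S : Finset (Fin N)) : Matrix (Fin 2) (S × Fin 2) (MomentaRing N) :=
  Matrix.of fun r ic => (momentum (ic.1 : Fin N)).transpose r ic.2

/-- The ideal of `R_N` generated by the maximal minors of `(k_i)_{i ∈ S}`. -/
def minorsPlus {N : ℕ} (S : Finset (Fin N)) : Ideal (MomentaRing N) :=
  Ideal.span (maximalMinors (rowPlus S))

/-- The ideal of `R_N` generated by the maximal minors of `(k_iᵀ)_{i ∈ S}`. -/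
def minorsMinus {N : ℕ} (S : Finset (Fin N)) : Ideal (MomentaRing N) :=
  Ideal.span (maximalMinors (rowMinus S))

/-- For `N = 4`, the ideal generated by the maximal minors of `(k_i)_{i ∈ S}` together with
those of `(k_iᵀ)_{i ∉ S}`; for `S = {1, 2}` this is `𝔭_{++--}`. -/
def mixedIdeal (S : Finset (Fin 4)) : Ideal (MomentaRing 4) :=
  Ideal.span (maximalMinors (rowPlus S) ∪ maximalMinors (rowMinus Sᶜ))

/-- The closed subset `V(𝔞)` of the momenta variety defined by an ideal `𝔞` of `R_N`, as a set of
`N`-tuples of complex `2 × 2` matrices: the common zeros of all polynomials whose class in `R_N`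
lies in `𝔞`. -/
def zeroLocus {N : ℕ} (𝔞 : Ideal (MomentaRing N)) : Set (Fin N → Matrix (Fin 2) (Fin 2) ℂ) :=
  {x | ∀ f : PolyRing N, Ideal.Quotient.mk (momentaIdeal N) f ∈ 𝔞 →
    MvPolynomial.eval (fun irc => x irc.1 irc.2.1 irc.2.2) f = 0}

end MomentaVariety

end

/-!
Every primality assertion is proved in the same way. For an ideal `I` of `MomentaRing N`, a domain
`D` is constructed together with `N` singular `2 × 2` matrices over `D` of sum zero which satisfy
the equations in `I` and are universal with this property; then `I` is the kernel of the induced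
map `MomentaRing N → D`, hence prime (`isPrime_of_factor`). Universality is needed only against
the quotient `MomentaRing N ⧸ I`, so that no dimension theory and no Nullstellensatz enters.

The domains come from two sources. The first is toric. For a bipartite graph the ring generated by
the monomials `λ_{row e} μ_{col e}` is a domain, and for a nested graph (`IsNested`) its relations
are generated by the `2 × 2` minors supported on the graph, since two multisets of edges with the
same vertex degrees are connected by exchanges of columns (`prod_eq_of_marginals`, `edgeLift`).
Block matrices such as `(k₁ k₂ k₃ k₄)` and the incomplete block matrix `(k₀ k₁; k₂ *)` are of this
kind; the latter parametrises the ideals `𝔭_S` for `N = 4`, with `k₀ = k_i + k_j = -(k_l + k_m)`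
(`sup_isPrime`).

The second source handles the condition that the sum vanish. Given singular matrices over a
domain, let `M` be the partial sum of all but three of them. Then the last three matrices amount
to two singular matrices `λ₁ μ₁ᵀ`, `λ₂ μ₂ᵀ` with `det (M + λ₁ μ₁ᵀ + λ₂ μ₂ᵀ) = 0`. This determinant
is linear in a variable, its leading coefficient is again linear in a variable, and so on; so it
is a prime element as soon as an entry of `M` is nonzero (`prime_pairDet`). The passage from `λ`,
`μ` to the matrix entries uses a retraction of the polynomial ring in `λ`, `μ` onto the edge ring
that is linear over the latter (`reynolds_mul`); it replaces the Reynolds operator of the torus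
that scales `λ_i` and `μ_i` inversely. The outcome is `exists_completion`: three free places
suffice to prescribe a sum. One application proves that the ideal of minors of `(k_i k_j)` is
prime for `N ≥ 5`, and two, for `J` and `Jᶜ`, prove that `(Q_J)` is prime when both sets have
three elements. The ideals of minors of transposed matrices follow by the automorphism
`transposition`.

That a prime over `(Q_{ij})` contains one of the two ideals of minors is the identity `det (λ μᵀ +
λ' μ'ᵀ) = (λ ∧ λ') (μ ∧ μ')` (`minorsPlus_le_or_minorsMinus_le`). For `N = 4` it applies to `{i,
j}` and to its complement, and the cases in which both pairs have parallel columns, or both have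
parallel rows, are split once more (`minorsPlus_univ_le_or`). Finally, inclusions between the
primes, and memberships `Q_K ∈ 𝔭` for `N ≥ 5`, are excluded by explicit complex points; for the
latter, diagonal matrices are enough (`eq_or_eq_compl_of_idealQ_le`).
-/


noncomputable section

namespace MomentaVariety

/-! ### Bipartite graphs and their monomial parametrisations -/

section Toric

variable {E I J : Type*} (row : E → I) (col : E → J)

/-- The bipartite graph with rows `I`, columns `J` and edge set `E` is simple, and its rows can be
ranked so that if two rows share a column, every column of the lower one is also a column of the
higher one. Complete bipartite graphs, their disjoint unions and Ferrers graphs are of this kind. -/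
structure IsNested (rk : I → ℕ) : Prop where
  inj : ∀ e e', row e = row e' → col e = col e' → e = e'
  swap : ∀ e₁ e₂ e₃, row e₃ = row e₁ → col e₃ = col e₂ → rk (row e₁) ≤ rk (row e₂) →
    ∃ e₄, row e₄ = row e₂ ∧ col e₄ = col e₁

/-- Values on the edges of a bipartite graph for which all `2 × 2` minors supported on the graph
vanish. -/
def MinorsVanish {M : Type*} [Mul M] (v : E → M) : Prop :=
  ∀ e₁ e₂ e₃ e₄, row e₃ = row e₁ → col e₃ = col e₂ → row e₄ = row e₂ → col e₄ = col e₁ →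
    v e₁ * v e₂ = v e₃ * v e₄

variable {row col}

/-- An edge whose ends both occur in a multiset of edges can be split off from it by exchanging the
columns of two of its edges; this changes neither the marginals nor, if the minors vanish, the
product of the values. -/
theorem exists_peel {rk : I → ℕ} (hG : IsNested row col rk) (e : E) (m : Multiset E)
    (hr : row e ∈ m.map row) (hc : col e ∈ m.map col)
    (hrk : ∀ e₂ ∈ m, rk (row e) ≤ rk (row e₂)) :
    ∃ m' : Multiset E, m.map row = row e ::ₘ m'.map row ∧ m.map col = col e ::ₘ m'.map col ∧
      ∀ {M : Type*} [CommMonoid M] (v : E → M), MinorsVanish row col v →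
        (m.map v).prod = v e * (m'.map v).prod := by
  obtain ⟨e₁, h₁, hr₁⟩ := Multiset.mem_map.1 hr
  obtain ⟨e₂, h₂, hc₂⟩ := Multiset.mem_map.1 hc
  have hrk₂ := hrk e₂ h₂
  obtain ⟨m₁, rfl⟩ := Multiset.exists_cons_of_mem h₁
  by_cases h : e₂ = e₁
  · subst h
    obtain rfl := hG.inj _ _ hr₁ hc₂
    exact ⟨m₁, by simp, by simp, fun v _ => by simp⟩
  · obtain ⟨m₂, rfl⟩ := Multiset.exists_cons_of_mem ((Multiset.mem_cons.1 h₂).resolve_left h)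
    obtain ⟨e₄, hr₄, hc₄⟩ := hG.swap e₁ e₂ e hr₁.symm hc₂.symm (hr₁ ▸ hrk₂)
    refine ⟨e₄ ::ₘ m₂, ?_, ?_, fun v hv => ?_⟩
    · simp [hr₁, hr₄]
    · simp only [Multiset.map_cons, hc₂, hc₄]
      exact Multiset.cons_swap _ _ _
    · simp only [Multiset.map_cons, Multiset.prod_cons, ← mul_assoc]
      rw [hv e₁ e₂ e e₄ hr₁.symm hc₂.symm hr₄ hc₄]

/-- If the minors of a nested graph vanish, the product over a multiset of edges depends only on the
vertex degrees. -/
theorem prod_eq_of_marginals {rk : I → ℕ} (hG : IsNested row col rk)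
    {M : Type*} [CommMonoid M] {v : E → M} (hv : MinorsVanish row col v)
    (m₁ m₂ : Multiset E) (hr : m₁.map row = m₂.map row) (hc : m₁.map col = m₂.map col) :
    (m₁.map v).prod = (m₂.map v).prod := by
  classical
  induction h : m₁.card generalizing m₁ m₂ with
  | zero =>
    obtain rfl := Multiset.card_eq_zero.1 h
    have : m₂ = 0 := by simpa [eq_comm] using hr
    simp [this]
  | succ n ih =>
    -- split off from `m₂` an edge of `m₁` whose row has the least rank
    obtain ⟨e, he, hmin⟩ := m₁.toFinset.exists_min_image (fun e => rk (row e)) (by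
      rw [Multiset.toFinset_nonempty]; rintro rfl; simp at h)
    rw [Multiset.mem_toFinset] at he
    obtain ⟨m', hr', hc', hp⟩ := exists_peel hG e m₂
      (hr ▸ Multiset.mem_map_of_mem row he) (hc ▸ Multiset.mem_map_of_mem col he) (by
        intro e₂ h₂
        obtain ⟨e₅, h₅, h₅'⟩ := Multiset.mem_map.1 (hr ▸ Multiset.mem_map_of_mem row h₂)
        rw [← h₅']
        exact hmin e₅ (by simpa using h₅))
    obtain ⟨m₁, rfl⟩ := Multiset.exists_cons_of_mem he
    rw [hp v hv, Multiset.map_cons, Multiset.prod_cons]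
    congr 1
    refine ih m₁ m' ?_ ?_ (by simpa using h)
    · rw [Multiset.map_cons, hr'] at hr
      exact (Multiset.cons_inj_right _).1 hr
    · rw [Multiset.map_cons, hc'] at hc
      exact (Multiset.cons_inj_right _).1 hc

variable (row col)

variable (A : Type*) [CommRing A]

/-- The monomial parametrisation `k_e ↦ λ_{row e} μ_{col e}` of a bipartite graph with edges `E`. -/
def edgeHom : MvPolynomial E A →ₐ[A] MvPolynomial (I ⊕ J) A :=
  MvPolynomial.aeval fun e => MvPolynomial.X (Sum.inl (row e)) * MvPolynomial.X (Sum.inr (col e))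

variable {A}

/-- The vertex multiset of a multiset of edges. -/
def endpoints (m : Multiset E) : Multiset (I ⊕ J) :=
  m.map (Sum.inl ∘ row) + m.map (Sum.inr ∘ col)

theorem endpoints_cons (e : E) (m : Multiset E) : endpoints row col (e ::ₘ m) =
    {Sum.inl (row e)} + {Sum.inr (col e)} + endpoints row col m := by
  simp only [endpoints, Multiset.map_cons, Function.comp_apply]
  simp only [← Multiset.singleton_add]
  abel

theorem filterMap_const_none {α β : Type*} (m : Multiset α) :
    m.filterMap (fun _ => (none : Option β)) = 0 := by
  induction m using Multiset.induction <;> simp_all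

theorem filterMap_some {α β : Type*} (f : α → β) (m : Multiset α) :
    m.filterMap (fun e => some (f e)) = m.map f :=
  congrFun (Multiset.filterMap_eq_map f) m

theorem map_eq_of_endpoints_eq {m₁ m₂ : Multiset E}
    (h : endpoints row col m₁ = endpoints row col m₂) :
    m₁.map row = m₂.map row ∧ m₁.map col = m₂.map col := by
  constructor
  · simpa [endpoints, Multiset.filterMap_add, Multiset.filterMap_map, Function.comp_def,
      filterMap_const_none, filterMap_some] using congrArg (Multiset.filterMap Sum.getLeft?) h
  · simpa [endpoints, Multiset.filterMap_add, Multiset.filterMap_map, Function.comp_def,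
      filterMap_const_none, filterMap_some] using congrArg (Multiset.filterMap Sum.getRight?) h

theorem edgeHom_prod [DecidableEq (I ⊕ J)] (m : Multiset E) :
    edgeHom row col A (m.map MvPolynomial.X).prod =
      MvPolynomial.monomial (Multiset.toFinsupp (endpoints row col m)) 1 := by
  induction m using Multiset.induction with
  | empty => simp [endpoints]
  | cons e m ih =>
    rw [Multiset.map_cons, Multiset.prod_cons, map_mul, ih, endpoints_cons, map_add, map_add,
      Multiset.toFinsupp_singleton, Multiset.toFinsupp_singleton, edgeHom, MvPolynomial.aeval_X,
      MvPolynomial.X, MvPolynomial.X, MvPolynomial.monomial_mul, MvPolynomial.monomial_mul]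
    simp

theorem induction_on_prod_X {σ : Type*} {P : MvPolynomial σ A → Prop} (f : MvPolynomial σ A)
    (hadd : ∀ f g, P f → P g → P (f + g))
    (hprod : ∀ (m : Multiset σ) (a : A), P (a • (m.map MvPolynomial.X).prod)) : P f := by
  classical
  induction f using MvPolynomial.induction_on' with
  | add f g hf hg => exact hadd f g hf hg
  | monomial u a =>
    have := hprod (Finsupp.toMultiset u) a
    rwa [Finsupp.toMultiset_map, Finsupp.prod_toMultiset, Finsupp.prod_mapDomain_index (by simp)
      (by simp [pow_add]), MvPolynomial.smul_eq_C_mul, ← MvPolynomial.monomial_eq] at this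

variable {C : Type*} [CommRing C] [Algebra A C]

open scoped Classical in
/-- The linear map that sends a product of edge monomials to the corresponding product of values
and kills all monomials that are not of this form. The edges of the product are chosen; the choice
does not matter if the graph is nested and the minors of `v` vanish. For the values in the edge ring
itself this is a retraction onto the edge ring, comparable to a Reynolds operator. -/
def reynolds (v : E → C) : MvPolynomial (I ⊕ J) A →ₗ[A] C :=
  (MvPolynomial.basisMonomials (I ⊕ J) A).constr A fun u =>
    if h : ∃ m : Multiset E, endpoints row col m = Finsupp.toMultiset u then
      (h.choose.map v).prod else 0

variable {row col} {rk : I → ℕ} {v : E → C}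

theorem reynolds_monomial [DecidableEq (I ⊕ J)] (hG : IsNested row col rk)
    (hv : MinorsVanish row col v) (m : Multiset E) (a : A) :
    reynolds row col v (MvPolynomial.monomial (Multiset.toFinsupp (endpoints row col m)) a) =
      a • (m.map v).prod := by
  have h1 : (MvPolynomial.monomial (Multiset.toFinsupp (endpoints row col m)) a) =
      a • MvPolynomial.basisMonomials (I ⊕ J) A (Multiset.toFinsupp (endpoints row col m)) := by
    simp [MvPolynomial.smul_monomial]
  rw [h1, map_smul, reynolds, Module.Basis.constr_basis]
  have h : ∃ m' : Multiset E, endpoints row col m' =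
      Finsupp.toMultiset (Multiset.toFinsupp (endpoints row col m)) := ⟨m, by simp⟩
  rw [dif_pos h]
  obtain ⟨hr, hc⟩ := map_eq_of_endpoints_eq row col
    (h.choose_spec.trans (Multiset.toFinsupp_toMultiset _))
  rw [prod_eq_of_marginals hG hv _ _ hr hc]

theorem reynolds_edgeHom (hG : IsNested row col rk) (hv : MinorsVanish row col v)
    (f : MvPolynomial E A) :
    reynolds row col v (edgeHom row col A f) = MvPolynomial.aeval v f := by
  classical
  induction f using induction_on_prod_X with
  | hadd f g hf hg => rw [map_add, map_add, map_add, hf, hg]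
  | hprod m a =>
    rw [map_smul, map_smul, map_smul, edgeHom_prod, reynolds_monomial hG hv, one_smul,
      map_multiset_prod, Multiset.map_map]
    simp

/-- If the rows need no ranking, that is, for disjoint unions of complete bipartite graphs, the map
`reynolds` is linear over the polynomial ring on the edges: every edge whose ends occur in a product
of edges can be split off, so a monomial outside the edge ring stays outside when it is multiplied
by an edge monomial. -/
theorem reynolds_mul (hG : IsNested row col fun _ => 0) (hv : MinorsVanish row col v)
    (f : MvPolynomial E A) (g : MvPolynomial (I ⊕ J) A) :
    reynolds row col v (edgeHom row col A f * g) =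
      MvPolynomial.aeval v f * reynolds row col v g := by
  classical
  induction f using MvPolynomial.induction_on generalizing g with
  | C a =>
    rw [← MvPolynomial.algebraMap_eq, AlgHom.commutes, AlgHom.commutes, ← Algebra.smul_def,
      ← Algebra.smul_def, map_smul]
  | add f₁ f₂ h₁ h₂ => rw [map_add, add_mul, map_add, h₁, h₂, map_add, add_mul]
  | mul_X f e hf =>
    rw [map_mul (edgeHom row col A), mul_assoc, hf, map_mul (MvPolynomial.aeval v), mul_assoc]
    congr 1
    induction g using MvPolynomial.induction_on' with
    | add g₁ g₂ h₁ h₂ => rw [mul_add, map_add, h₁, h₂, map_add, mul_add]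
    | monomial u a =>
      have key : edgeHom row col A (MvPolynomial.X e) * MvPolynomial.monomial u a =
          MvPolynomial.monomial (Multiset.toFinsupp
            ({Sum.inl (row e)} + {Sum.inr (col e)} + Finsupp.toMultiset u)) a := by
        rw [map_add, map_add, Multiset.toFinsupp_singleton, Multiset.toFinsupp_singleton, edgeHom,
          MvPolynomial.aeval_X, MvPolynomial.X, MvPolynomial.X, MvPolynomial.monomial_mul,
          MvPolynomial.monomial_mul]
        simp
      by_cases h : ∃ m : Multiset E, endpoints row col m = Finsupp.toMultiset u
      · obtain ⟨m, hm⟩ := h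
        have hu : u = Multiset.toFinsupp (endpoints row col m) := by rw [hm]; simp
        rw [key, ← hm, ← endpoints_cons, hu, reynolds_monomial hG hv, reynolds_monomial hG hv]
        simp
      · have h' : ¬ ∃ m : Multiset E, endpoints row col m =
            {Sum.inl (row e)} + {Sum.inr (col e)} + Finsupp.toMultiset u := by
          rintro ⟨m, hm⟩
          have hmem (x) : x ∈ endpoints row col m ↔
              x = Sum.inl (row e) ∨ x = Sum.inr (col e) ∨ x ∈ Finsupp.toMultiset u := by
            rw [hm]; simp [-Finsupp.mem_toMultiset]
          have hr : row e ∈ m.map row := by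
            simpa [endpoints] using (hmem (Sum.inl (row e))).2 (Or.inl rfl)
          have hc : col e ∈ m.map col := by
            simpa [endpoints] using (hmem (Sum.inr (col e))).2 (Or.inr (Or.inl rfl))
          obtain ⟨m', hr', hc', -⟩ := exists_peel.{_, _, _, 0} hG e m hr hc (by simp)
          refine h ⟨m', ?_⟩
          have : endpoints row col m = endpoints row col (e ::ₘ m') := by
            rw [endpoints, endpoints, ← Multiset.map_map, ← Multiset.map_map, ← Multiset.map_map,
              ← Multiset.map_map, hr', hc', Multiset.map_cons row, Multiset.map_cons col]
          rw [this, endpoints_cons] at hm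
          exact add_left_cancel hm
        have hz (w : I ⊕ J →₀ ℕ) (hw : ¬ ∃ m : Multiset E, endpoints row col m =
            Finsupp.toMultiset w) : reynolds row col v (MvPolynomial.monomial w a) = 0 := by
          have h1 : MvPolynomial.monomial w a = a • MvPolynomial.basisMonomials (I ⊕ J) A w := by
            simp [MvPolynomial.smul_monomial]
          rw [h1, map_smul, reynolds, Module.Basis.constr_basis, dif_neg hw, smul_zero]
        rw [key, hz u h, hz _ (by rwa [Multiset.toFinsupp_toMultiset]), mul_zero]

end Toric

/-! ### Edge rings -/

section Toric

variable {E I J : Type*} (row : E → I) (col : E → J) (A : Type*) [CommRing A]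

/-- The edge ring of a bipartite graph, that is, the ring generated by the monomials
`λ_{row e} μ_{col e}`, presented as a quotient of the polynomial ring on the edges. -/
abbrev EdgeRing : Type _ := MvPolynomial E A ⧸ RingHom.ker (edgeHom row col A)

instance edgeRing_isDomain [IsDomain A] : IsDomain (EdgeRing row col A) :=
  haveI := RingHom.ker_isPrime (edgeHom row col A)
  Ideal.Quotient.isDomain _

/-- The generator of the edge ring given by an edge. -/
def edgeVar (e : E) : EdgeRing row col A := Ideal.Quotient.mk _ (MvPolynomial.X e)

theorem minorsVanish_edgeVar : MinorsVanish row col (edgeVar row col A) := by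
  intro e₁ e₂ e₃ e₄ h₁ h₂ h₃ h₄
  rw [edgeVar, edgeVar, edgeVar, edgeVar, ← map_mul, ← map_mul, Ideal.Quotient.eq,
    RingHom.mem_ker, map_sub, map_mul, map_mul]
  simp only [edgeHom, MvPolynomial.aeval_X, h₁, h₂, h₃, h₄]
  ring

variable {A} {row col} {C : Type*} [CommRing C] [Algebra A C]

/-- The universal property of the edge ring of a nested graph: the only relations between its
generators are the `2 × 2` minors supported on the graph. -/
def edgeLift {rk : I → ℕ} (hG : IsNested row col rk) {v : E → C} (hv : MinorsVanish row col v) :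
    EdgeRing row col A →ₐ[A] C :=
  Ideal.Quotient.liftₐ _ (MvPolynomial.aeval v) fun f hf => by
    rw [← reynolds_edgeHom hG hv f, (RingHom.mem_ker).1 hf, map_zero]

@[simp] theorem edgeLift_edgeVar {rk : I → ℕ} (hG : IsNested row col rk) {v : E → C}
    (hv : MinorsVanish row col v) (e : E) :
    edgeLift (A := A) hG hv (edgeVar row col A e) = v e :=
  (Ideal.Quotient.lift_mk _ _ _).trans (MvPolynomial.aeval_X v e)

end Toric

/-! ### Prime polynomials that are linear in a variable -/

section Linear

/-- The base ring need not be factorial: if `p` vanishes at `-b / a`, its leading coefficient is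
divisible by `a` because the prime `a` does not divide `b`, so division by `a X + b` is possible. -/
theorem prime_C_mul_X_add_C {D : Type*} [CommRing D] [IsDomain D] {a b : D}
    (ha : Prime a) (hab : ¬ a ∣ b) : Prime (Polynomial.C a * Polynomial.X + Polynomial.C b) := by
  set f : Polynomial D := Polynomial.C a * Polynomial.X + Polynomial.C b with hf
  let K := FractionRing D
  obtain ⟨x, hx⟩ : ∃ x : K, algebraMap D K a * x = -(algebraMap D K b) := by
    have ha' : algebraMap D K a ≠ 0 := by
      rw [Ne, IsFractionRing.to_map_eq_zero_iff]; exact ha.ne_zero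
    exact ⟨-(algebraMap D K b) / algebraMap D K a, mul_div_cancel₀ _ ha'⟩
  have hfdeg : f.natDegree = 1 := Polynomial.natDegree_linear ha.ne_zero
  have hfx : Polynomial.aeval x f = 0 := by
    simp only [hf, map_add, map_mul, Polynomial.aeval_C, Polynomial.aeval_X, hx]
    exact neg_add_cancel _
  have hf0 : f ≠ 0 := fun h => by simp [h] at hfdeg
  -- `f` generates the kernel of the evaluation at `-b / a`
  have key : ∀ (n : ℕ) (p : Polynomial D), p.natDegree ≤ n → Polynomial.aeval x p = 0 → f ∣ p := by
    intro n
    induction n with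
    | zero =>
      intro p hp h
      rw [Polynomial.eq_C_of_natDegree_le_zero hp, Polynomial.aeval_C,
        IsFractionRing.to_map_eq_zero_iff] at h
      rw [Polynomial.eq_C_of_natDegree_le_zero hp, h]
      simp
    | succ n ih =>
      intro p hp h
      have hdvd : a ∣ p.coeff (n + 1) := by
        have h1 : ∑ i ∈ Finset.range (n + 2), p.coeff i * (-b) ^ i * a ^ (n + 1 - i) = 0 := by
          rw [← IsFractionRing.to_map_eq_zero_iff (K := K), map_sum]
          rw [Polynomial.aeval_eq_sum_range' (Nat.lt_succ_of_le hp)] at h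
          rw [← mul_zero ((algebraMap D K a) ^ (n + 1)), ← h, Finset.mul_sum]
          refine Finset.sum_congr rfl fun i hi => ?_
          have hi' : i ≤ n + 1 := Nat.lt_succ_iff.1 (Finset.mem_range.1 hi)
          rw [Algebra.smul_def]
          simp only [map_mul, map_pow, map_neg, ← hx, mul_pow]
          conv_rhs => rw [← Nat.sub_add_cancel hi', pow_add]
          ring
        rw [Finset.sum_range_succ] at h1
        have h2 : a ∣ ∑ i ∈ Finset.range (n + 1), p.coeff i * (-b) ^ i * a ^ (n + 1 - i) := by
          refine Finset.dvd_sum fun i hi => Dvd.dvd.mul_left (dvd_pow_self a ?_) _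
          have := Finset.mem_range.1 hi
          omega
        have h3 : a ∣ p.coeff (n + 1) * (-b) ^ (n + 1) := by
          have := (dvd_add_right h2).1 (h1 ▸ dvd_zero a)
          simpa using this
        refine (ha.dvd_or_dvd h3).resolve_right fun h4 => hab ?_
        have := ha.dvd_of_dvd_pow h4
        rwa [dvd_neg] at this
      obtain ⟨c, hc⟩ := hdvd
      have hq := ih (p - Polynomial.C c * Polynomial.X ^ n * f) ?_ ?_
      · have := dvd_add hq (Dvd.intro_left (Polynomial.C c * Polynomial.X ^ n) rfl : f ∣ _)
        rwa [sub_add_cancel] at this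
      · have hexp : Polynomial.C c * Polynomial.X ^ n * f =
            Polynomial.C (p.coeff (n + 1)) * Polynomial.X ^ (n + 1) +
              Polynomial.C (c * b) * Polynomial.X ^ n := by
          rw [hc, hf]; simp only [map_mul]; ring
        rw [Polynomial.natDegree_le_iff_coeff_eq_zero]
        intro N hN
        rw [hexp, Polynomial.coeff_sub, Polynomial.coeff_add, Polynomial.coeff_C_mul_X_pow,
          Polynomial.coeff_C_mul_X_pow]
        rcases Nat.lt_or_ge (n + 1) N with h5 | h5
        · rw [Polynomial.coeff_eq_zero_of_natDegree_lt (by omega), if_neg (by omega),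
            if_neg (by omega)]
          simp
        · obtain rfl : N = n + 1 := by omega
          simp
      · rw [map_sub, map_mul _ _ f, hfx, h]
        simp
  have hker : RingHom.ker (Polynomial.aeval x : Polynomial D →ₐ[D] K) = Ideal.span {f} := by
    ext p
    rw [RingHom.mem_ker, Ideal.mem_span_singleton]
    refine ⟨fun h => key _ p le_rfl h, ?_⟩
    rintro ⟨q, rfl⟩
    rw [map_mul, hfx, zero_mul]
  rw [← Ideal.span_singleton_prime hf0, ← hker]
  exact RingHom.ker_isPrime _

/-- A polynomial that is linear in the variable `X i` is prime if its leading coefficient is prime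
and does not divide its constant coefficient; that these do not involve `X i` is expressed by their
invariance under the substitution `X i ↦ 0`. -/
theorem prime_mul_X_add {D τ : Type*} [CommRing D] [IsDomain D] [DecidableEq τ]
    (i : τ) {a b : MvPolynomial τ D}
    (ha₀ : MvPolynomial.aeval (Function.update MvPolynomial.X i (0 : MvPolynomial τ D)) a = a)
    (hb₀ : MvPolynomial.aeval (Function.update MvPolynomial.X i (0 : MvPolynomial τ D)) b = b)
    (ha : Prime a) (hab : ¬ a ∣ b) : Prime (a * MvPolynomial.X i + b) := by
  let e : MvPolynomial τ D ≃ₐ[D] Polynomial (MvPolynomial {j // j ≠ i} D) :=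
    (MvPolynomial.renameEquiv D (Equiv.optionSubtypeNe i).symm).trans
      (MvPolynomial.optionEquivLeft D _)
  have hex : ∀ c : MvPolynomial τ D,
      MvPolynomial.aeval (Function.update MvPolynomial.X i (0 : MvPolynomial τ D)) c = c →
      ∃ c' : MvPolynomial {j // j ≠ i} D, c = MvPolynomial.rename Subtype.val c' := by
    intro c hc
    refine ⟨MvPolynomial.aeval (fun j => if h : j = i then 0 else MvPolynomial.X ⟨j, h⟩) c, ?_⟩
    conv_lhs => rw [← hc]
    rw [← AlgHom.comp_apply]
    congr 1
    ext j : 1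
    by_cases h : j = i
    · subst h; simp
    · simp [h]
  obtain ⟨a', rfl⟩ := hex a ha₀
  obtain ⟨b', rfl⟩ := hex b hb₀
  have hC : ∀ c : MvPolynomial {j // j ≠ i} D,
      e (MvPolynomial.rename Subtype.val c) = Polynomial.C c := by
    intro c
    simp only [e, AlgEquiv.trans_apply, MvPolynomial.renameEquiv_apply, MvPolynomial.rename_rename]
    induction c using MvPolynomial.induction_on with
    | C r => simp [MvPolynomial.optionEquivLeft_apply]
    | add p q hp hq => simp only [map_add, hp, hq]
    | mul_X p j hp =>
      rw [map_mul, map_mul, hp, map_mul]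
      simp [MvPolynomial.optionEquivLeft_apply, Equiv.optionSubtypeNe_symm_of_ne j.2]
  have hX : e (MvPolynomial.X i) = Polynomial.X := by
    simp [e, MvPolynomial.optionEquivLeft_apply]
  rw [← MulEquiv.prime_iff e.toMulEquiv]
  change Prime (e _)
  rw [map_add, map_mul, hC, hC, hX]
  refine prime_C_mul_X_add_C ?_ fun h => hab (map_dvd _ h)
  exact (MvPolynomial.prime_rename_iff {j | j ≠ i}).1 ha

end Linear

/-! ### Families of matrices as labellings of edges -/

section Matrices

variable {ι κ : Type*}

/-- The row of the entry `(i, r, c)` of a family of `2 × 2` matrices that are arranged in blocks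
`(k_i)_{π i = s}` with two rows, one block for each `s`. -/
def blockRow (π : ι → κ) (e : ι × Fin 2 × Fin 2) : κ × Fin 2 := (π e.1, e.2.1)

/-- The column of the entry `(i, r, c)` in its block. -/
def blockCol (e : ι × Fin 2 × Fin 2) : ι × Fin 2 := (e.1, e.2.2)

theorem isNested_block (π : ι → κ) (rk : κ × Fin 2 → ℕ) : IsNested (blockRow π) blockCol rk where
  inj := by
    rintro ⟨i, r, c⟩ ⟨i', r', c'⟩ h h'
    simp only [blockRow, blockCol, Prod.mk.injEq] at h h' ⊢
    exact ⟨h'.1, h.2, h'.2⟩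
  swap := by
    rintro ⟨i₁, r₁, c₁⟩ ⟨i₂, r₂, c₂⟩ ⟨i₃, r₃, c₃⟩ h h' -
    simp only [blockRow, blockCol, Prod.mk.injEq] at h h'
    obtain ⟨rfl, rfl⟩ := h'
    exact ⟨(i₁, r₂, c₁), by simp [blockRow, h.1], by simp [blockCol]⟩

variable {C : Type*} [CommRing C]

/-- The entries of a family of `2 × 2` matrices, as a function on the set of all positions. -/
def entries (y : ι → Matrix (Fin 2) (Fin 2) C) (e : ι × Fin 2 × Fin 2) : C := y e.1 e.2.1 e.2.2

theorem minorsVanish_entries {π : ι → κ} {y : ι → Matrix (Fin 2) (Fin 2) C}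
    (h : ∀ i j, π i = π j → ∀ c c', y i 0 c * y j 1 c' - y i 1 c * y j 0 c' = 0) :
    MinorsVanish (blockRow π) blockCol (entries y) := by
  rintro ⟨i, r, c⟩ ⟨j, r', c'⟩ ⟨i₃, r₃, c₃⟩ ⟨i₄, r₄, c₄⟩ h₁ h₂ h₃ h₄
  simp only [blockRow, blockCol, Prod.mk.injEq] at h₁ h₂ h₃ h₄
  obtain ⟨rfl, rfl⟩ := h₂
  obtain ⟨rfl, rfl⟩ := h₄
  obtain ⟨h₁, rfl⟩ := h₁
  obtain ⟨-, rfl⟩ := h₃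
  have := h _ _ h₁ c₃ c₄
  simp only [entries]
  fin_cases r₃ <;> fin_cases r₄ <;> grind

theorem minorsVanish_entries_of_det {y : ι → Matrix (Fin 2) (Fin 2) C}
    (h : ∀ i, (y i).det = 0) : MinorsVanish (blockRow id) blockCol (entries y) := by
  refine minorsVanish_entries ?_
  rintro i _ rfl c c'
  have := h i
  rw [Matrix.det_fin_two] at this
  simp only [id]
  fin_cases c <;> fin_cases c' <;> grind

end Matrices

/-! ### Two singular matrices whose sum with a given matrix is singular -/

section Pair

variable {D : Type*} [CommRing D] (M : Matrix (Fin 2) (Fin 2) D)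

/-- The polynomial ring in the entries of vectors `λ₁`, `λ₂` (left summand) and `μ₁`, `μ₂` (right
summand) with two components. -/
abbrev PairPoly (D : Type*) [CommRing D] : Type _ :=
  MvPolynomial ((Fin 2 × Fin 2) ⊕ (Fin 2 × Fin 2)) D

/-- The determinant of `M + λ₁ μ₁ᵀ + λ₂ μ₂ᵀ`. -/
def pairDet : PairPoly D :=
  Matrix.det (Matrix.of fun r c => MvPolynomial.C (M r c) +
    ∑ i : Fin 2, MvPolynomial.X (Sum.inl (i, r)) * MvPolynomial.X (Sum.inr (i, c)))

/-- The determinant is linear in the second component of `μ₁`; its leading coefficient is linear in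
the first component of `μ₂`, with leading coefficient `λ₂ ∧ λ₁`. -/
theorem prime_pairDet [IsDomain D] (hM : M 0 0 ≠ 0) : Prime (pairDet M) := by
  classical
  let x : Fin 2 → PairPoly D := fun r => MvPolynomial.X (Sum.inl (0, r))
  let y : Fin 2 → PairPoly D := fun r => MvPolynomial.X (Sum.inl (1, r))
  let t : Fin 2 → PairPoly D := fun r => MvPolynomial.X (Sum.inr (0, r))
  let s : Fin 2 → PairPoly D := fun r => MvPolynomial.X (Sum.inr (1, r))
  let m : Fin 2 → Fin 2 → PairPoly D := fun r c => MvPolynomial.C (M r c)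
  let ev : (Fin 2 → D) → (Fin 2 → D) → (Fin 2 → D) → (Fin 2 → D) → PairPoly D →ₐ[D] D :=
    fun x y t s => MvPolynomial.aeval
      (Sum.elim (fun p => if p.1 = 0 then x p.2 else y p.2)
        (fun p => if p.1 = 0 then t p.2 else s p.2))
  have hev : ∀ (x' y' t' s' : Fin 2 → D) (r : Fin 2), ev x' y' t' s' (x r) = x' r ∧
      ev x' y' t' s' (y r) = y' r ∧ ev x' y' t' s' (t r) = t' r ∧ ev x' y' t' s' (s r) = s' r ∧
      ∀ c, ev x' y' t' s' (m r c) = M r c := by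
    intro x' y' t' s' r
    simp [ev, x, y, t, s, m, MvPolynomial.aeval_X]
  -- the determinants `λ₂ ∧ λ₁` and `(M + λ₂ μ₂ᵀ) ∧ λ₁`, the latter formed with the first column
  let d := x 1 * y 0 + -(y 1 * x 0)
  let a := d * s 0 + (m 0 0 * x 1 - m 1 0 * x 0)
  let b := (m 0 0 + s 0 * y 0) * (m 1 1 + s 1 * y 1) -
    (m 1 0 + s 0 * y 1) * (m 0 1 + s 1 * y 0) +
      t 0 * (x 0 * (m 1 1 + s 1 * y 1) - x 1 * (m 0 1 + s 1 * y 0))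
  have hd : Prime d := by
    refine prime_mul_X_add (Sum.inl (1, 0)) (by simp [x]) (by simp [x, y])
      (MvPolynomial.X_prime) fun h => ?_
    have h' := map_dvd (ev ![1, 0] ![0, 1] 0 0) h
    simp [map_neg, map_mul, hev] at h'
  have ha : Prime a := by
    refine prime_mul_X_add (Sum.inr (1, 0)) (by simp [d, x, y]) (by simp [x, m])
      hd fun h => hM ?_
    have h' := map_dvd (ev ![0, 1] 0 0 0) h
    simpa [d, map_neg, map_mul, map_sub, map_add, hev] using h'
  have hF : pairDet M = a * t 1 + b := by
    simp only [pairDet, Matrix.det_fin_two, Matrix.of_apply, Fin.sum_univ_two, a, b, d, x, y, t, s,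
      m]
    ring
  rw [hF]
  refine prime_mul_X_add (Sum.inr (0, 1)) (by simp [a, d, x, y, s, m])
    (by simp [b, x, y, t, s, m]) ha fun h => hM ?_
  -- at `λ₂ = -M e₁`, `μ₂ = (1, q)` the divisor vanishes, and `b` is `q M₁₁ - M₁₂` for suitable
  -- `λ₁`, `μ₁`
  have h' (q : D) := map_dvd (ev ![0, 1] ![-(M 0 0), -(M 1 0)] ![1, 0] ![1, q]) h
  have h0 := h' 0
  have h1 := h' 1
  simp [a, b, d, map_neg, map_mul, map_sub, map_add, hev] at h0 h1
  simpa [h0] using h1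

/-- The relations between the entries of `λ₁ μ₁ᵀ` and `λ₂ μ₂ᵀ` modulo `pairDet M`. -/
def pairIdeal : Ideal (MvPolynomial (Fin 2 × Fin 2 × Fin 2) D) :=
  (Ideal.span {pairDet M}).comap (edgeHom (blockRow id) blockCol D)

/-- The universal `D`-algebra with two singular `2 × 2` matrices whose sum with `M` is singular. -/
abbrev PairRing : Type _ := MvPolynomial (Fin 2 × Fin 2 × Fin 2) D ⧸ pairIdeal M

theorem pairIdeal_isPrime [IsDomain D] (hM : M 0 0 ≠ 0) : (pairIdeal M).IsPrime :=
  haveI := (Ideal.span_singleton_prime (prime_pairDet M hM).ne_zero).2 (prime_pairDet M hM)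
  Ideal.comap_isPrime _ _

theorem pairRing_isDomain [IsDomain D] (hM : M 0 0 ≠ 0) : IsDomain (PairRing M) :=
  haveI := pairIdeal_isPrime M hM
  Ideal.Quotient.isDomain _

/-- The two generic matrices over `PairRing M`. -/
def pairVar (i : Fin 2) : Matrix (Fin 2) (Fin 2) (PairRing M) :=
  Matrix.of fun r c => Ideal.Quotient.mk _ (MvPolynomial.X (i, r, c))

theorem det_pairVar (i : Fin 2) : (pairVar M i).det = 0 := by
  rw [Matrix.det_fin_two]
  simp only [pairVar, Matrix.of_apply]
  rw [← map_mul, ← map_mul, ← map_sub, Ideal.Quotient.eq_zero_iff_mem, pairIdeal, Ideal.mem_comap]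
  convert Ideal.zero_mem _
  simp only [edgeHom, map_sub, map_mul, MvPolynomial.aeval_X, blockRow, blockCol]
  ring

theorem edgeHom_det_add : edgeHom (blockRow id) blockCol D (Matrix.det (Matrix.of fun r c =>
    MvPolynomial.C (M r c) + MvPolynomial.X (0, r, c) + MvPolynomial.X (1, r, c))) = pairDet M := by
  simp only [pairDet, edgeHom, Matrix.det_fin_two, Matrix.of_apply, Fin.sum_univ_two, map_sub,
    map_mul, map_add, MvPolynomial.aeval_X, blockRow, blockCol, MvPolynomial.aeval_C, id]
  simp only [MvPolynomial.algebraMap_eq]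
  ring

theorem det_add_pairVar :
    (M.map (algebraMap D (PairRing M)) + pairVar M 0 + pairVar M 1).det = 0 := by
  have h : Ideal.Quotient.mk (pairIdeal M) (Matrix.det (Matrix.of fun r c =>
      MvPolynomial.C (M r c) + MvPolynomial.X (0, r, c) + MvPolynomial.X (1, r, c))) = 0 := by
    rw [Ideal.Quotient.eq_zero_iff_mem, pairIdeal, Ideal.mem_comap, edgeHom_det_add]
    exact Ideal.mem_span_singleton_self _
  rw [← h, RingHom.map_det]
  congr 1

variable {C : Type*} [CommRing C] [Algebra D C]

/-- The universal property of `PairRing M`. The extension of an ideal of the edge ring to the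
polynomial ring contracts to itself, because `reynolds` is a retraction that is linear over the edge
ring. -/
def pairLift (y : Fin 2 → Matrix (Fin 2) (Fin 2) C) (hy : ∀ i, (y i).det = 0)
    (hs : (M.map (algebraMap D C) + y 0 + y 1).det = 0) : PairRing M →ₐ[D] C :=
  Ideal.Quotient.liftₐ _ (MvPolynomial.aeval (entries y)) fun f hf => by
    have hG := isNested_block (id : Fin 2 → Fin 2) fun _ => 0
    have hv := minorsVanish_entries_of_det hy
    obtain ⟨g, hg⟩ := Ideal.mem_span_singleton'.1 hf
    rw [← reynolds_edgeHom hG hv f]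
    erw [← hg]
    rw [← edgeHom_det_add, mul_comm, reynolds_mul hG hv]
    convert zero_mul _
    rw [← hs, AlgHom.map_det]
    congr 1
    ext r c
    simp [entries]

@[simp] theorem pairLift_pairVar (y : Fin 2 → Matrix (Fin 2) (Fin 2) C) (hy : ∀ i, (y i).det = 0)
    (hs : (M.map (algebraMap D C) + y 0 + y 1).det = 0) (i r c) :
    pairLift M y hy hs (pairVar M i r c) = y i r c :=
  (Ideal.Quotient.lift_mk _ _ _).trans (MvPolynomial.aeval_X _ _)

/-- Over the base ring itself, `M` can be completed by the negatives of its two columns. -/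
theorem algebraMap_pairRing_injective : Function.Injective (algebraMap D (PairRing M)) := by
  let f : PairRing M →ₐ[D] D := pairLift M
    ![!![-(M 0 0), 0; -(M 1 0), 0], !![0, -(M 0 1); 0, -(M 1 1)]]
    (by intro i; fin_cases i <;> simp [Matrix.det_fin_two])
    (by simp [Matrix.det_fin_two])
  exact Function.LeftInverse.injective (g := f) fun d => f.commutes d

end Pair

/-! ### Points of the momenta variety and ideals of minors -/

section MomentaRing

variable {N : ℕ}

theorem det_momentum (i : Fin N) : (momentum i).det = 0 := by
  have : (momentum i).det = Ideal.Quotient.mk (momentaIdeal N) (polyMomentum i).det := by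
    rw [RingHom.map_det]; rfl
  rw [this, Ideal.Quotient.eq_zero_iff_mem]
  exact Ideal.subset_span (Or.inr ⟨i, rfl⟩)

theorem sum_momentum : ∑ i : Fin N, momentum i = 0 := by
  ext r c
  have : (∑ i : Fin N, momentum i) r c =
      Ideal.Quotient.mk (momentaIdeal N) ((∑ i : Fin N, polyMomentum i) r c) := by
    simp [Matrix.sum_apply, momentum]
  rw [this, Matrix.zero_apply, Ideal.Quotient.eq_zero_iff_mem]
  exact Ideal.subset_span (Or.inl ⟨(r, c), rfl⟩)

variable {D : Type*} [CommRing D] [Algebra ℂ D]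

/-- The `D`-valued point of the momenta variety given by `N` singular matrices with sum zero. -/
def momentaLift (y : Fin N → Matrix (Fin 2) (Fin 2) D) (hy : ∀ i, (y i).det = 0)
    (hs : ∑ i, y i = 0) : MomentaRing N →ₐ[ℂ] D :=
  Ideal.Quotient.liftₐ _ (MvPolynomial.aeval (entries y)) fun f hf => by
    have hle : momentaIdeal N ≤
        RingHom.ker (MvPolynomial.aeval (entries y) : PolyRing N →ₐ[ℂ] D) := by
      have hX (i : Fin N) (r c : Fin 2) :
          MvPolynomial.aeval (entries y) (polyMomentum i r c) = y i r c := by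
        simp [polyMomentum, entries]
      rw [momentaIdeal, Ideal.span_le]
      rintro _ (⟨⟨r, c⟩, rfl⟩ | ⟨i, rfl⟩)
      · rw [SetLike.mem_coe, RingHom.mem_ker]
        simp only [Matrix.sum_apply, map_sum, hX]
        rw [← Matrix.sum_apply, hs, Matrix.zero_apply]
      · rw [SetLike.mem_coe, RingHom.mem_ker]
        beta_reduce
        rw [Matrix.det_fin_two]
        simp only [map_sub, map_mul, hX]
        rw [← Matrix.det_fin_two, hy]
    exact hle hf

section

variable {y : Fin N → Matrix (Fin 2) (Fin 2) D} {hy : ∀ i, (y i).det = 0} {hs : ∑ i, y i = 0}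

@[simp] theorem momentaLift_momentum (i : Fin N) (r c : Fin 2) :
    momentaLift y hy hs (momentum i r c) = y i r c :=
  (Ideal.Quotient.lift_mk _ _ _).trans (MvPolynomial.aeval_X _ _)

theorem momentaLift_mk (f : PolyRing N) :
    momentaLift y hy hs (Ideal.Quotient.mk _ f) = MvPolynomial.aeval (entries y) f :=
  Ideal.Quotient.lift_mk _ _ _

theorem momentaLift_Q (J : Finset (Fin N)) : momentaLift y hy hs (Q J) = (∑ i ∈ J, y i).det := by
  simp [Q, Matrix.det_fin_two, Matrix.sum_apply]

end

theorem momentaRing_algHom_ext {f g : MomentaRing N →ₐ[ℂ] D}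
    (h : ∀ i r c, f (momentum i r c) = g (momentum i r c)) : f = g := by
  refine Ideal.Quotient.algHom_ext _ (MvPolynomial.algHom_ext fun ⟨i, r, c⟩ => ?_)
  exact h i r c

/-- An ideal `I` is prime if its generic point `MomentaRing N → MomentaRing N ⧸ I` factors through
a domain-valued point on which `I` vanishes. -/
theorem isPrime_of_factor [IsDomain D] {I : Ideal (MomentaRing N)}
    (y : Fin N → Matrix (Fin 2) (Fin 2) D) (hy : ∀ i, (y i).det = 0) (hs : ∑ i, y i = 0)
    (hI : I ≤ RingHom.ker (momentaLift y hy hs)) (h : D →ₐ[ℂ] MomentaRing N ⧸ I)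
    (hh : ∀ i r c, h (y i r c) = Ideal.Quotient.mk I (momentum i r c)) : I.IsPrime := by
  have hcomp : h.comp (momentaLift y hy hs) = Ideal.Quotient.mkₐ ℂ I := by
    refine momentaRing_algHom_ext (D := MomentaRing N ⧸ I) fun i r c => ?_
    rw [AlgHom.comp_apply, momentaLift_momentum, hh]
    rfl
  have : I = RingHom.ker (momentaLift y hy hs) := by
    refine le_antisymm hI fun f hf => ?_
    rw [← Ideal.Quotient.eq_zero_iff_mem, ← Ideal.Quotient.mkₐ_eq_mk ℂ, ← hcomp,
      AlgHom.comp_apply, (RingHom.mem_ker).1 hf, map_zero]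
  rw [this]
  exact RingHom.ker_isPrime _

theorem minorsPlus_le_iff {S : Finset (Fin N)} {I : Ideal (MomentaRing N)} :
    minorsPlus S ≤ I ↔ ∀ i ∈ S, ∀ j ∈ S, ∀ c c' : Fin 2,
      momentum i 0 c * momentum j 1 c' - momentum i 1 c * momentum j 0 c' ∈ I := by
  rw [minorsPlus, Ideal.span_le]
  constructor
  · intro h i hi j hj c c'
    by_cases hne : (⟨i, hi⟩, c) = ((⟨j, hj⟩, c') : S × Fin 2)
    · simp only [Prod.mk.injEq, Subtype.mk.injEq] at hne
      obtain ⟨rfl, rfl⟩ := hne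
      convert I.zero_mem using 1
      ring
    · have hinj : Function.Injective ![((⟨i, hi⟩, c) : S × Fin 2), (⟨j, hj⟩, c')] := by
        intro a b hab
        fin_cases a <;> fin_cases b <;> simp_all
      have := h ⟨⟨_, hinj⟩, rfl⟩
      rw [SetLike.mem_coe] at this
      beta_reduce at this
      rw [Matrix.det_fin_two] at this
      simp [rowPlus] at this
      convert this using 1
      ring
  · rintro h _ ⟨e, rfl⟩
    rw [SetLike.mem_coe]
    beta_reduce
    rw [Matrix.det_fin_two]
    simp only [rowPlus, Matrix.submatrix_apply, Matrix.of_apply, id]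
    convert h _ (e 0).1.2 _ (e 1).1.2 (e 0).2 (e 1).2 using 1
    ring

/-! ### Transposition -/

/-- The involution of the momenta ring that transposes all matrices. -/
def transposition : MomentaRing N →ₐ[ℂ] MomentaRing N :=
  momentaLift (fun i => (momentum i).transpose)
    (fun i => by rw [Matrix.det_transpose, det_momentum])
    (by rw [← Matrix.transpose_sum, sum_momentum, Matrix.transpose_zero])

@[simp] theorem transposition_momentum (i : Fin N) (r c : Fin 2) :
    transposition (momentum i r c) = momentum i c r :=
  momentaLift_momentum i r c

theorem transposition_transposition (x : MomentaRing N) : transposition (transposition x) = x := by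
  have : (transposition (N := N)).comp transposition = AlgHom.id ℂ _ :=
    momentaRing_algHom_ext fun i r c => by simp
  exact DFunLike.congr_fun this x

theorem transposition_Q (J : Finset (Fin N)) : transposition (Q J) = Q J := by
  rw [transposition, momentaLift_Q, ← Matrix.transpose_sum, Matrix.det_transpose, Q]

theorem comap_transposition_le_iff {I K : Ideal (MomentaRing N)} :
    I.comap transposition ≤ K ↔ I ≤ K.comap transposition := by
  constructor
  · intro h x hx
    exact h (by rwa [Ideal.mem_comap, transposition_transposition])
  · intro h x hx
    simpa [transposition_transposition] using h hx

theorem map_transposition_eq_comap (I : Ideal (MomentaRing N)) :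
    I.map transposition = I.comap transposition := by
  refine le_antisymm (Ideal.map_le_iff_le_comap.2 fun x hx => ?_) fun x hx => ?_
  · rwa [Ideal.mem_comap, Ideal.mem_comap, transposition_transposition]
  · rw [← transposition_transposition x]
    exact Ideal.mem_map_of_mem _ hx

theorem minorsMinus_eq_comap (S : Finset (Fin N)) :
    minorsMinus S = (minorsPlus S).comap transposition := by
  rw [← map_transposition_eq_comap, minorsPlus, minorsMinus, Ideal.map_span, maximalMinors,
    maximalMinors, ← Set.range_comp]
  congr 2
  ext e
  simp [rowPlus, rowMinus, Matrix.det_fin_two]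

theorem minorsPlus_eq_comap (S : Finset (Fin N)) :
    minorsPlus S = (minorsMinus S).comap transposition := by
  rw [minorsMinus_eq_comap]
  ext x
  simp [transposition_transposition]

theorem minorsMinus_le_iff {S : Finset (Fin N)} {I : Ideal (MomentaRing N)} :
    minorsMinus S ≤ I ↔ ∀ i ∈ S, ∀ j ∈ S, ∀ r r' : Fin 2,
      momentum i r 0 * momentum j r' 1 - momentum i r 1 * momentum j r' 0 ∈ I := by
  rw [minorsMinus_eq_comap, comap_transposition_le_iff, minorsPlus_le_iff]
  simp

/-! ### The elements `Q_J` -/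

theorem mixedIdeal_eq_sup (S : Finset (Fin 4)) : mixedIdeal S = minorsPlus S ⊔ minorsMinus Sᶜ :=
  Ideal.span_union _ _

theorem sum_momentum_compl (J : Finset (Fin N)) :
    ∑ i ∈ J, momentum i = -∑ i ∈ Jᶜ, momentum i := by
  rw [eq_neg_iff_add_eq_zero, Finset.sum_add_sum_compl, sum_momentum]

theorem det_neg_fin_two {A : Type*} [CommRing A] (K : Matrix (Fin 2) (Fin 2) A) :
    (-K).det = K.det := by
  rw [Matrix.det_fin_two, Matrix.det_fin_two]
  simp

theorem Q_compl (J : Finset (Fin N)) : Q Jᶜ = Q J := by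
  rw [Q, Q, sum_momentum_compl J, det_neg_fin_two]

theorem idealQ_compl (J : Finset (Fin N)) : idealQ Jᶜ = idealQ J := by
  rw [idealQ, idealQ, Q_compl]

theorem Q_pair {i j : Fin N} (hij : i ≠ j) : Q {i, j} = (momentum i + momentum j).det := by
  rw [Q, Finset.sum_pair hij]

theorem idealQ_pair_le_minorsPlus {i j : Fin N} (hij : i ≠ j) :
    idealQ {i, j} ≤ minorsPlus {i, j} := by
  rw [idealQ, Ideal.span_singleton_le_iff_mem, Q_pair hij]
  have h := minorsPlus_le_iff.1 (le_refl (minorsPlus {i, j}))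
  have h01 := h i (by simp) j (by simp) 0 1
  have h10 := h i (by simp) j (by simp) 1 0
  convert Ideal.sub_mem _ h01 h10 using 1
  have hi := det_momentum i
  have hj := det_momentum j
  rw [Matrix.det_fin_two] at hi hj ⊢
  simp only [Matrix.add_apply]
  linear_combination hi + hj

theorem idealQ_pair_le_minorsMinus {i j : Fin N} (hij : i ≠ j) :
    idealQ {i, j} ≤ minorsMinus {i, j} := by
  rw [minorsMinus_eq_comap, idealQ, Ideal.span_singleton_le_iff_mem, Ideal.mem_comap,
    transposition_Q, ← Ideal.span_singleton_le_iff_mem]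
  exact idealQ_pair_le_minorsPlus hij

/-- For `K = λ μᵀ` and `L = λ' μ'ᵀ` this is `det (K + L) = (λ ∧ λ') (μ ∧ μ')`, multiplied by
entries of `K` and `L` so that it makes sense without a factorisation. -/
theorem minor_mul_minor {A : Type*} [CommRing A] (K L : Matrix (Fin 2) (Fin 2) A) (hK : K.det = 0)
    (hL : L.det = 0) (r r' c c' : Fin 2) :
    (K 0 c * L 1 c' - K 1 c * L 0 c') * (K r 0 * L r' 1 - K r 1 * L r' 0) =
      K r c * L r' c' * (K + L).det := by
  rw [Matrix.det_fin_two] at hK hL ⊢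
  simp only [Matrix.add_apply]
  fin_cases r <;> fin_cases r' <;> fin_cases c <;> fin_cases c' <;> simp <;> grind

theorem minor_self {A : Type*} [CommRing A] {K : Matrix (Fin 2) (Fin 2) A} (hK : K.det = 0)
    (c c' : Fin 2) : K 0 c * K 1 c' - K 1 c * K 0 c' = 0 := by
  rw [Matrix.det_fin_two] at hK
  fin_cases c <;> fin_cases c' <;> simp <;> grind

theorem minorsPlus_pair_le_iff {i j : Fin N} {I : Ideal (MomentaRing N)} :
    minorsPlus {i, j} ≤ I ↔ ∀ c c' : Fin 2,
      momentum i 0 c * momentum j 1 c' - momentum i 1 c * momentum j 0 c' ∈ I := by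
  rw [minorsPlus_le_iff]
  refine ⟨fun h => h i (by simp) j (by simp), fun h a ha b hb c c' => ?_⟩
  rw [Finset.mem_insert, Finset.mem_singleton] at ha hb
  rcases ha with rfl | rfl <;> rcases hb with rfl | rfl
  · rw [minor_self (det_momentum _)]; exact I.zero_mem
  · exact h c c'
  · convert I.neg_mem (h c' c) using 1
    ring
  · rw [minor_self (det_momentum _)]; exact I.zero_mem

theorem minorsMinus_pair_le_iff {i j : Fin N} {I : Ideal (MomentaRing N)} :
    minorsMinus {i, j} ≤ I ↔ ∀ r r' : Fin 2,
      momentum i r 0 * momentum j r' 1 - momentum i r 1 * momentum j r' 0 ∈ I := by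
  rw [minorsMinus_eq_comap, comap_transposition_le_iff, minorsPlus_pair_le_iff]
  simp

theorem minorsPlus_le_or_minorsMinus_le {i j : Fin N} (hij : i ≠ j) {p : Ideal (MomentaRing N)}
    (hp : p.IsPrime) (hQ : idealQ {i, j} ≤ p) : minorsPlus {i, j} ≤ p ∨ minorsMinus {i, j} ≤ p := by
  rw [idealQ, Ideal.span_singleton_le_iff_mem, Q_pair hij] at hQ
  rw [minorsPlus_pair_le_iff, minorsMinus_pair_le_iff]
  by_contra! hcon
  obtain ⟨⟨c, c', h₁⟩, r, r', h₂⟩ := hcon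
  have h := Ideal.mul_mem_left p (momentum i r c * momentum j r' c') hQ
  rw [← minor_mul_minor _ _ (det_momentum i) (det_momentum j)] at h
  exact (hp.mem_or_mem h).elim h₁ h₂

end MomentaRing

/-! ### Completing a family of matrices to one with a prescribed sum -/

section Completion

/-- The universal property of `PairRing M` for homomorphisms that need not fix the base ring `D`. -/
theorem exists_pairRing_hom {k D C : Type*} [CommRing k] [CommRing D] [Algebra k D] [CommRing C]
    [Algebra k C] (M : Matrix (Fin 2) (Fin 2) D) (h₀ : D →ₐ[k] C)
    (y : Fin 2 → Matrix (Fin 2) (Fin 2) C) (hy : ∀ i, (y i).det = 0)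
    (hs : (M.map h₀ + y 0 + y 1).det = 0) :
    ∃ h : PairRing M →ₐ[k] C, (∀ d, h (algebraMap D _ d) = h₀ d) ∧
      ∀ i r c, h (pairVar M i r c) = y i r c := by
  let := h₀.toRingHom.toAlgebra
  have : IsScalarTower k D C := IsScalarTower.of_algebraMap_eq' h₀.comp_algebraMap.symm
  exact ⟨(pairLift M y hy hs).restrictScalars k, fun d => (pairLift M y hy hs).commutes d,
    fun i r c => pairLift_pairVar M y hy hs i r c⟩

theorem sum_update_three {ι A : Type*} [DecidableEq ι] [AddCommGroup A] {T : Finset ι} {a b c : ι}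
    (ha : a ∈ T) (hb : b ∈ T) (hc : c ∈ T) (hab : a ≠ b) (hac : a ≠ c) (hbc : b ≠ c) (s : ι → A)
    (u v w : A) :
    ∑ i ∈ T, Function.update (Function.update (Function.update s a u) b v) c w i =
      u + v + w + ∑ i ∈ T \ {a, b, c}, s i := by
  have hsub : ({a, b, c} : Finset ι) ⊆ T := by
    intro x hx
    simp only [Finset.mem_insert, Finset.mem_singleton] at hx
    rcases hx with rfl | rfl | rfl <;> assumption
  rw [← Finset.sum_sdiff hsub, add_comm, Finset.sum_insert (by simp [hab, hac]),
    Finset.sum_insert (by simp [hbc]), Finset.sum_singleton]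
  congr 1
  · simp [hab, hac, hbc, add_assoc]
  · refine Finset.sum_congr rfl fun i hi => ?_
    simp only [Finset.mem_sdiff, Finset.mem_insert, Finset.mem_singleton, not_or] at hi
    simp [hi.2.1, hi.2.2.1, hi.2.2.2]

/-- Over a domain, a family of singular matrices can be changed at three places so that the sum
over a set `T` containing these places becomes a given matrix `R`, in a universal way and without
leaving the world of domains. Two of the three new matrices are the generic ones of a `PairRing`,
the third is determined by the sum. The last clause of the statement is the universal property of
the new family `y` over `D₁`. -/
theorem exists_completion {N : ℕ} {D : Type} [CommRing D] [Algebra ℂ D] [IsDomain D]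
    (s : Fin N → Matrix (Fin 2) (Fin 2) D) (hs : ∀ i, (s i).det = 0) {T : Finset (Fin N)}
    {a b c : Fin N} (ha : a ∈ T) (hb : b ∈ T) (hc : c ∈ T) (hab : a ≠ b) (hac : a ≠ c)
    (hbc : b ≠ c) (R : Matrix (Fin 2) (Fin 2) D)
    (hR : (∑ i ∈ T \ {a, b, c}, s i - R) 0 0 ≠ 0) :
    ∃ (D₁ : Type) (_ : CommRing D₁) (_ : Algebra ℂ D₁) (_ : IsDomain D₁) (f : D →ₐ[ℂ] D₁)
      (y : Fin N → Matrix (Fin 2) (Fin 2) D₁), Function.Injective f ∧ (∀ i, (y i).det = 0) ∧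
      (∀ i ∉ ({a, b, c} : Finset (Fin N)), y i = (s i).map f) ∧ ∑ i ∈ T, y i = R.map f ∧
      ∀ (C : Type) [CommRing C] [Algebra ℂ C] (h₀ : D →ₐ[ℂ] C)
        (z : Fin N → Matrix (Fin 2) (Fin 2) C), (∀ i, (z i).det = 0) →
        (∀ i ∉ ({a, b, c} : Finset (Fin N)), (s i).map h₀ = z i) → ∑ i ∈ T, z i = R.map h₀ →
        ∃ h : D₁ →ₐ[ℂ] C, (∀ d, h (f d) = h₀ d) ∧ ∀ i, (y i).map h = z i := by
  classical
  set M := ∑ i ∈ T \ {a, b, c}, s i - R with hM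
  have := pairRing_isDomain M hR
  let f : D →ₐ[ℂ] PairRing M := IsScalarTower.toAlgHom ℂ D (PairRing M)
  have hf : (f : D → PairRing M) = algebraMap D (PairRing M) := rfl
  have hMap {C : Type} [CommRing C] [Algebra ℂ C] (g : D →ₐ[ℂ] C) :
      M.map g = ∑ i ∈ T \ {a, b, c}, (s i).map g - R.map g := by
    ext r c
    simp [hM, Matrix.sum_apply]
  let y : Fin N → Matrix (Fin 2) (Fin 2) (PairRing M) :=
    Function.update (Function.update (Function.update (fun i => (s i).map f) a (pairVar M 0))
      b (pairVar M 1)) c (-(M.map f + pairVar M 0 + pairVar M 1))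
  have hya : y a = pairVar M 0 := by simp [y, hab, hac]
  have hyb : y b = pairVar M 1 := by simp [y, hbc]
  have hyc : y c = -(M.map f + pairVar M 0 + pairVar M 1) := by simp [y]
  have hy : ∀ i ∉ ({a, b, c} : Finset (Fin N)), y i = (s i).map f := by
    intro i hi
    simp only [Finset.mem_insert, Finset.mem_singleton, not_or] at hi
    simp [y, hi.1, hi.2.1, hi.2.2]
  refine ⟨PairRing M, inferInstance, inferInstance, this, f, y, algebraMap_pairRing_injective M,
    fun i => ?_, hy, ?_, ?_⟩
  · by_cases hi : i ∈ ({a, b, c} : Finset (Fin N))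
    · simp only [Finset.mem_insert, Finset.mem_singleton] at hi
      rcases hi with rfl | rfl | rfl
      · rw [hya, det_pairVar]
      · rw [hyb, det_pairVar]
      · rw [hyc, det_neg_fin_two, hf, det_add_pairVar]
    · rw [hy i hi]
      change (f.mapMatrix (s i)).det = 0
      rw [← AlgHom.map_det, hs, map_zero]
  · rw [sum_update_three ha hb hc hab hac hbc, hMap]
    abel
  · intro C _ _ h₀ z hz hsz hzT
    have hzT' : z c = -(M.map h₀ + z a + z b) := by
      have h1 := sum_update_three ha hb hc hab hac hbc z (z a) (z b) (z c)
      simp only [Function.update_eq_self] at h1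
      rw [hzT] at h1
      rw [hMap, h1, Finset.sum_congr rfl fun i hi => hsz i (Finset.mem_sdiff.1 hi).2]
      abel
    obtain ⟨h, h1, h2⟩ := exists_pairRing_hom M h₀ ![z a, z b]
      (by intro i; fin_cases i <;> simp [hz])
      (by
        have := hz c
        rwa [hzT', det_neg_fin_two] at this)
    have h2' (i) : (pairVar M i).map h = ![z a, z b] i := by
      ext r c; exact h2 i r c
    have h1' (A : Matrix (Fin 2) (Fin 2) D) : (A.map f).map h = A.map h₀ := by
      ext r c; exact h1 _
    refine ⟨h, h1, fun i => ?_⟩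
    by_cases hi : i ∈ ({a, b, c} : Finset (Fin N))
    · simp only [Finset.mem_insert, Finset.mem_singleton] at hi
      rcases hi with rfl | rfl | rfl
      · rw [hya, h2']; rfl
      · rw [hyb, h2']; rfl
      · rw [hyc, hzT', ← h1' M]
        have e0 : z a = (pairVar M 0).map h := (h2' 0).symm
        have e1 : z b = (pairVar M 1).map h := (h2' 1).symm
        rw [e0, e1]
        ext r c
        simp
    · rw [hy i hi, h1', hsz i hi]

end Completion

/-! ### Primality for at least five momenta -/

section Primes

variable {N : ℕ} {κ : Type} (π : Fin N → κ)

/-- The coordinate ring of the families of matrices such that, for each `s`, the matrices `k_i` with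
`π i = s` form a block with two rows of rank at most one. -/
abbrev BlockRing : Type := EdgeRing (blockRow π) blockCol ℂ

/-- The generic matrices over `BlockRing π`. -/
def blockVar (i : Fin N) : Matrix (Fin 2) (Fin 2) (BlockRing π) :=
  Matrix.of fun r c => edgeVar (blockRow π) blockCol ℂ (i, r, c)

theorem blockVar_minor {i j : Fin N} (h : π i = π j) (c c' : Fin 2) :
    blockVar π i 0 c * blockVar π j 1 c' - blockVar π i 1 c * blockVar π j 0 c' = 0 := by
  have := minorsVanish_edgeVar (blockRow π) blockCol ℂ (i, 0, c) (j, 1, c') (j, 0, c') (i, 1, c)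
    (by simp [blockRow, h]) (by simp [blockCol]) (by simp [blockRow, h]) (by simp [blockCol])
  simp only [blockVar, Matrix.of_apply]
  rw [this]
  ring

theorem det_blockVar (i : Fin N) : (blockVar π i).det = 0 := by
  rw [Matrix.det_fin_two]
  linear_combination blockVar_minor π (rfl : π i = π i) 0 1

theorem exists_blockRing_hom {C : Type*} [CommRing C] [Algebra ℂ C]
    (z : Fin N → Matrix (Fin 2) (Fin 2) C)
    (hz : ∀ i j, π i = π j → ∀ c c', z i 0 c * z j 1 c' - z i 1 c * z j 0 c' = 0) :
    ∃ h : BlockRing π →ₐ[ℂ] C, ∀ i, (blockVar π i).map h = z i := by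
  refine ⟨edgeLift (isNested_block π fun _ => 0) (minorsVanish_entries hz), fun i => ?_⟩
  ext r c
  simp [blockVar, entries]

theorem exists_blockRing_eval (w : Fin N → ℂ) :
    ∃ h : BlockRing π →ₐ[ℂ] ℂ, ∀ i, h (blockVar π i 0 0) = w i := by
  obtain ⟨h, hh⟩ := exists_blockRing_hom π (fun i => !![w i, 0; 0, 0]) (by simp)
  exact ⟨h, fun i => by simpa using congrFun (congrFun (hh i) 0) 0⟩

theorem det_map_mk_eq_zero {I : Ideal (MomentaRing N)}
    {K : Matrix (Fin 2) (Fin 2) (MomentaRing N)} (hK : K.det ∈ I) :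
    (K.map (Ideal.Quotient.mk I)).det = 0 := by
  rw [Matrix.det_fin_two] at hK ⊢
  simp only [Matrix.map_apply]
  rw [← map_mul, ← map_mul, ← map_sub]
  exact Ideal.Quotient.eq_zero_iff_mem.2 hK

theorem mk_map_momentum_det {I : Ideal (MomentaRing N)} (i : Fin N) :
    ((momentum i).map (Ideal.Quotient.mk I)).det = 0 :=
  det_map_mk_eq_zero (by rw [det_momentum]; exact I.zero_mem)

theorem sum_mk_map_momentum {I : Ideal (MomentaRing N)} (J : Finset (Fin N)) :
    ∑ i ∈ J, (momentum i).map (Ideal.Quotient.mk I) =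
      (∑ i ∈ J, momentum i).map (Ideal.Quotient.mk I) := by
  ext r c
  simp [Matrix.sum_apply]

/-- The universal family has a block `(k_i k_j)` of rank at most one and is completed at three
further places; the condition `5 ≤ N` provides them. -/
theorem minorsPlus_pair_isPrime (hN : 5 ≤ N) {i j : Fin N} (hij : i ≠ j) :
    (minorsPlus {i, j}).IsPrime := by
  classical
  obtain ⟨a, b, c, hab, hac, hbc, habc⟩ :
      ∃ a b c : Fin N, a ≠ b ∧ a ≠ c ∧ b ≠ c ∧ ({a, b, c} : Finset (Fin N)) ⊆ {i, j}ᶜ := by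
    have : 2 < ({i, j} : Finset (Fin N))ᶜ.card := by
      rw [Finset.card_compl, Fintype.card_fin, Finset.card_pair hij]; omega
    obtain ⟨a, ha, b, hb, c, hc, h⟩ := Finset.two_lt_card.1 this
    exact ⟨a, b, c, h.1, h.2.1, h.2.2, by
      simp only [Finset.insert_subset_iff, Finset.singleton_subset_iff]
      exact ⟨ha, hb, hc⟩⟩
  have hi : i ∉ ({a, b, c} : Finset (Fin N)) := fun h => by simpa using habc h
  have hj : j ∉ ({a, b, c} : Finset (Fin N)) := fun h => by simpa using habc h
  -- one block for `i` and `j`, and one for each other index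
  let π : Fin N → Fin N := fun x => if x = j then i else x
  have hπ : π i = π j := by simp [π]
  have hne : (∑ x ∈ Finset.univ \ {a, b, c}, blockVar π x - 0) 0 0 ≠ 0 := by
    -- evaluate where only `k_i` is nonzero
    obtain ⟨h, hh⟩ := exists_blockRing_eval π (Pi.single i 1)
    intro h0
    have := congrArg h h0
    rw [sub_zero, Matrix.sum_apply, map_sum, map_zero] at this
    simp only [hh] at this
    simp only [Pi.single_apply, Finset.sum_ite_eq'] at this
    rw [if_pos (by simpa using hi)] at this
    exact one_ne_zero this
  obtain ⟨D, _, _, _, f, y, -, hy, hys, hyT, huniv⟩ := exists_completion (blockVar π)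
    (det_blockVar π) (Finset.mem_univ a) (Finset.mem_univ b) (Finset.mem_univ c) hab hac hbc 0 hne
  have hsum : ∑ x, y x = 0 := by rw [hyT]; ext r c; simp
  have hI := fun x => (Ideal.Quotient.eq_zero_iff_mem (I := minorsPlus {i, j}) (a := x)).2
  obtain ⟨h₀, hh₀⟩ := exists_blockRing_hom π
    (fun x => (momentum x).map (Ideal.Quotient.mk (minorsPlus {i, j}))) (by
      intro x x' hxx c c'
      simp only [Matrix.map_apply]
      rw [← map_mul, ← map_mul, ← map_sub]
      apply hI
      have hmem := minorsPlus_le_iff.1 (le_refl (minorsPlus {i, j}))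
      by_cases hx : x = x'
      · subst hx
        rw [minor_self (det_momentum _)]
        exact Ideal.zero_mem _
      · -- `π` identifies only `i` and `j`
        have : x ∈ ({i, j} : Finset (Fin N)) ∧ x' ∈ ({i, j} : Finset (Fin N)) := by
          simp only [π] at hxx
          simp only [Finset.mem_insert, Finset.mem_singleton]
          grind
        exact hmem x this.1 x' this.2 c c')
  obtain ⟨h, -, hh⟩ := huniv _ h₀ (fun x => (momentum x).map (Ideal.Quotient.mk _))
    (fun x => mk_map_momentum_det x) (fun x _ => hh₀ x)
    (by rw [sum_mk_map_momentum, sum_momentum]; ext r c; simp)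
  refine isPrime_of_factor y hy hsum ?_ h fun x r c => congrFun (congrFun (hh x) r) c
  rw [minorsPlus_pair_le_iff]
  intro c c'
  rw [RingHom.mem_ker, map_sub, map_mul, map_mul]
  simp only [momentaLift_momentum]
  rw [hys i hi, hys j hj]
  simp only [Matrix.map_apply]
  rw [← map_mul, ← map_mul, ← map_sub, blockVar_minor π hπ, map_zero]

/-- The universal family starts from a free singular matrix `P`, is completed at three places of `J`
so that `k_J = P`, and then at three places of `Jᶜ` so that `k_{Jᶜ} = -P`. -/
theorem idealQ_isPrime {J : Finset (Fin N)} (hJ : 3 ≤ J.card) (hJ' : 3 ≤ Jᶜ.card) :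
    (idealQ J).IsPrime := by
  classical
  obtain ⟨a, ha, b, hb, c, hc, hab, hac, hbc⟩ := Finset.two_lt_card.1 (show 2 < J.card from hJ)
  obtain ⟨a', ha', b', hb', c', hc', hab', hac', hbc'⟩ :=
    Finset.two_lt_card.1 (show 2 < Jᶜ.card from hJ')
  have hsub : ({a, b, c} : Finset (Fin N)) ⊆ J := by
    simp [Finset.insert_subset_iff, ha, hb, hc]
  have hsub' : ({a', b', c'} : Finset (Fin N)) ⊆ Jᶜ := by
    simp only [Finset.insert_subset_iff, Finset.singleton_subset_iff]
    exact ⟨ha', hb', hc'⟩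
  have hJn {x : Fin N} (hx : x ∈ J) : x ∉ ({a', b', c'} : Finset (Fin N)) :=
    fun h => (Finset.mem_compl.1 (hsub' h)) hx
  have hJn' {x : Fin N} (hx : x ∈ Jᶜ) : x ∉ ({a, b, c} : Finset (Fin N)) :=
    fun h => (Finset.mem_compl.1 hx) (hsub h)
  let π : Fin N → Fin N := id
  -- the place `a` will be overwritten in the completion, so its free matrix can be used for `P`
  let P := blockVar π a
  have hne : (∑ x ∈ J \ {a, b, c}, blockVar π x - P) 0 0 ≠ 0 := by
    obtain ⟨h, hh⟩ := exists_blockRing_eval π (Pi.single a 1)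
    intro h0
    have := congrArg h h0
    rw [Matrix.sub_apply, Matrix.sum_apply, map_sub, map_sum, map_zero] at this
    simp only [hh, P] at this
    simp only [Pi.single_apply, Finset.sum_ite_eq'] at this
    rw [if_neg (by simp)] at this
    simp at this
  obtain ⟨D₁, _, _, _, f, y, hf, hy, hys, hyT, huniv⟩ := exists_completion (blockVar π)
    (det_blockVar π) ha hb hc hab hac hbc P hne
  have hne' : (∑ x ∈ Jᶜ \ {a', b', c'}, y x - -(P.map f)) 0 0 ≠ 0 := by
    obtain ⟨h, hh⟩ := exists_blockRing_eval π (Pi.single a 1)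
    intro h0
    have h1 : f (∑ x ∈ Jᶜ \ {a', b', c'}, blockVar π x 0 0 + P 0 0) = 0 := by
      rw [← h0, map_add, map_sum, Matrix.sub_apply, Matrix.sum_apply, Matrix.neg_apply,
        sub_neg_eq_add]
      congr 1
      refine Finset.sum_congr rfl fun x hx => ?_
      rw [hys x (hJn' (Finset.mem_sdiff.1 hx).1)]
      rfl
    have := congrArg h ((map_eq_zero_iff f hf).1 h1)
    rw [map_add, map_sum, map_zero] at this
    simp only [hh, P] at this
    simp only [Pi.single_apply, Finset.sum_ite_eq'] at this
    rw [if_neg (by simp [ha])] at this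
    simp at this
  obtain ⟨D₂, _, _, _, f₂, y₂, -, hy₂, hys₂, hyT₂, huniv₂⟩ := exists_completion y hy ha' hb' hc'
    hab' hac' hbc' (-(P.map f)) hne'
  have hsumJ : ∑ x ∈ J, y₂ x = (P.map f).map f₂ := by
    rw [← hyT, Finset.sum_congr rfl fun x hx => hys₂ x (hJn hx)]
    ext r c
    simp [Matrix.sum_apply]
  have hsum : ∑ x, y₂ x = 0 := by
    rw [← Finset.sum_add_sum_compl J, hsumJ, hyT₂]
    ext r c
    simp
  let z : Fin N → Matrix (Fin 2) (Fin 2) (MomentaRing N ⧸ idealQ J) :=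
    fun x => (momentum x).map (Ideal.Quotient.mk _)
  have hz (x) : (z x).det = 0 := mk_map_momentum_det x
  have hQ : (∑ x ∈ J, z x).det = 0 := by
    rw [sum_mk_map_momentum]
    exact det_map_mk_eq_zero (Ideal.mem_span_singleton_self _)
  have hupd (x) : (Function.update z a (∑ x ∈ J, z x) x).det = 0 := by
    by_cases hx : x = a
    · subst hx; simpa using hQ
    · simpa [hx] using hz x
  obtain ⟨h₀, hh₀⟩ := exists_blockRing_hom π (Function.update z a (∑ x ∈ J, z x)) (by
    rintro x _ rfl c c'
    exact minor_self (hupd x) c c')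
  have hP : P.map h₀ = ∑ x ∈ J, z x := by rw [hh₀]; simp
  obtain ⟨h₁, h₁f, hh₁⟩ := huniv _ h₀ z hz
    (fun x hx => by
      have hxa : x ≠ a := by rintro rfl; simp at hx
      rw [hh₀, Function.update_of_ne hxa]) hP.symm
  obtain ⟨h₂, -, hh₂⟩ := huniv₂ _ h₁ z hz (fun x _ => hh₁ x) (by
    have h1 : (P.map f).map h₁ = ∑ x ∈ J, z x := by
      rw [← hP]; ext r c; exact h₁f _
    have h2 : (-(P.map f)).map h₁ = -((P.map f).map h₁) := by ext r c; simp
    rw [h2, h1, sum_mk_map_momentum, sum_mk_map_momentum, sum_momentum_compl J]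
    ext r c
    simp)
  refine isPrime_of_factor y₂ hy₂ hsum ?_ h₂ fun x r c => congrFun (congrFun (hh₂ x) r) c
  rw [idealQ, Ideal.span_singleton_le_iff_mem, RingHom.mem_ker, momentaLift_Q, hsumJ]
  change (f₂.mapMatrix (f.mapMatrix P)).det = 0
  rw [← AlgHom.map_det, ← AlgHom.map_det, det_blockVar, map_zero, map_zero]

end Primes

/-! ### Primality for four momenta -/

section Four

theorem sum_eq_of_compl_eq {A : Type*} [AddCommMonoid A] {i j l m : Fin 4} (hij : i ≠ j)
    (hlm : l ≠ m) (hS : ({i, j} : Finset (Fin 4))ᶜ = {l, m}) (y : Fin 4 → A) :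
    ∑ x, y x = y i + y j + (y l + y m) := by
  rw [← Finset.sum_add_sum_compl {i, j}, hS, Finset.sum_pair hij, Finset.sum_pair hlm]

/-- If the columns of `s 0`, `s 1`, `s 2` are parallel, so are those of `s 0`, `s 1`, `s 2` and
`-(s 0 + s 1 + s 2)`. -/
theorem minor_of_sum_eq_zero {C : Type*} [CommRing C] {s y : Fin 4 → Matrix (Fin 2) (Fin 2) C}
    (h0 : y 0 = s 0) (h1 : y 1 = s 1) (h2 : y 2 = s 2) (h3 : y 3 = -(s 0 + s 1 + s 2))
    {c c' : Fin 2} (h : ∀ i j, s i 0 c * s j 1 c' - s i 1 c * s j 0 c' = 0) (i j : Fin 4) :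
    y i 0 c * y j 1 c' - y i 1 c * y j 0 c' = 0 := by
  fin_cases i <;> fin_cases j <;>
    simp only [Fin.zero_eta, Fin.mk_one, Fin.reduceFinMk, h0, h1, h2, h3, Matrix.neg_apply,
      Matrix.add_apply] <;> grind

theorem minorsPlus_univ_isPrime : (minorsPlus (Finset.univ : Finset (Fin 4))).IsPrime := by
  let π : Fin 4 → Unit := fun _ => ()
  let s := blockVar π
  have hs (i j : Fin 4) (c c' : Fin 2) : s i 0 c * s j 1 c' - s i 1 c * s j 0 c' = 0 :=
    blockVar_minor π rfl c c'
  -- the last matrix is determined by the sum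
  let y : Fin 4 → Matrix (Fin 2) (Fin 2) (BlockRing π) := ![s 0, s 1, s 2, -(s 0 + s 1 + s 2)]
  have hy (i j : Fin 4) (c c' : Fin 2) : y i 0 c * y j 1 c' - y i 1 c * y j 0 c' = 0 :=
    minor_of_sum_eq_zero (s := s) (y := y) rfl rfl rfl rfl (fun i j => hs i j c c') i j
  have hydet (i) : (y i).det = 0 := by
    rw [Matrix.det_fin_two]
    linear_combination hy i i 0 1
  have hsum : ∑ i, y i = 0 := by
    simp [Fin.sum_univ_four, y]
  let I := minorsPlus (Finset.univ : Finset (Fin 4))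
  have hI := minorsPlus_le_iff.1 (le_refl I)
  obtain ⟨h, hh⟩ := exists_blockRing_hom π (fun x => (momentum x).map (Ideal.Quotient.mk I)) (by
    intro i j _ c c'
    simp only [Matrix.map_apply]
    rw [← map_mul, ← map_mul, ← map_sub]
    exact Ideal.Quotient.eq_zero_iff_mem.2 (hI i (Finset.mem_univ i) j (Finset.mem_univ j) c c'))
  refine isPrime_of_factor y hydet hsum ?_ h fun i r c => ?_
  · rw [minorsPlus_le_iff]
    intro i _ j _ c c'
    rw [RingHom.mem_ker, map_sub, map_mul, map_mul]
    simp only [momentaLift_momentum]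
    exact hy i j c c'
  · have hh' (i r c) : h (s i r c) = Ideal.Quotient.mk I (momentum i r c) :=
      congrFun (congrFun (hh i) r) c
    have h3 := congrFun (congrFun (sum_momentum (N := 4)) r) c
    simp only [Fin.sum_univ_four, Matrix.add_apply, Matrix.zero_apply] at h3
    rw [← eq_neg_iff_add_eq_zero, ← neg_eq_iff_eq_neg] at h3
    fin_cases i
    · exact hh' 0 r c
    · exact hh' 1 r c
    · exact hh' 2 r c
    · simp only [y]
      change h (-(s 0 r c + s 1 r c + s 2 r c)) = Ideal.Quotient.mk I (momentum 3 r c)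
      rw [← h3, map_neg, map_add, map_add, hh', hh', hh', map_neg, map_add, map_add]

theorem minorsMinus_isPrime {N : ℕ} {S : Finset (Fin N)} (h : (minorsPlus S).IsPrime) :
    (minorsMinus S).IsPrime := by
  rw [minorsMinus_eq_comap]
  exact Ideal.comap_isPrime _ _

/-- The row map of the graph of a block matrix `(k₀ k₁; k₂ *)` of `2 × 2` matrices without its last
block; the row of blocks is `true` for the second one. -/
def ladderRow (e : Fin 3 × Fin 2 × Fin 2) : Bool × Fin 2 := (e.1 = 2, e.2.1)

/-- The column map of the graph of a block matrix `(k₀ k₁; k₂ *)` of `2 × 2` matrices without its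
last block; the column of blocks is `true` for the second one. -/
def ladderCol (e : Fin 3 × Fin 2 × Fin 2) : Bool × Fin 2 := (e.1 = 1, e.2.2)

/-- The rows of the incomplete second row of blocks come lower. -/
theorem isNested_ladder :
    IsNested ladderRow ladderCol fun p => if p.1 then 0 else 1 where
  inj := by
    rintro ⟨i, r, c⟩ ⟨i', r', c'⟩ h h'
    simp only [ladderRow, ladderCol, Prod.mk.injEq, decide_eq_decide] at h h' ⊢
    refine ⟨?_, h.2, h'.2⟩
    omega
  swap := by
    rintro ⟨i₁, r₁, c₁⟩ ⟨i₂, r₂, c₂⟩ ⟨i₃, r₃, c₃⟩ h h' hrk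
    by_cases h1 : i₁ = 1
    · by_cases h2 : i₂ = 2
      · simp [ladderRow, h1, h2] at hrk
      · exact ⟨(1, r₂, c₁), by simp [ladderRow, h2], by simp [ladderCol, h1]⟩
    · by_cases h2 : i₂ = 2
      · exact ⟨(2, r₂, c₁), by simp [ladderRow, h2], by simp [ladderCol, h1]⟩
      · exact ⟨(0, r₂, c₁), by simp [ladderRow, h2], by simp [ladderCol, h1]⟩

/-- The minors of `(k₀ k₁; k₂ *)` that do not meet the missing block are those of the block row
`(k₀ k₁)` and of the block column `(k₀; k₂)`. -/
theorem minorsVanish_ladder {C : Type*} [CommRing C] {z : Fin 3 → Matrix (Fin 2) (Fin 2) C}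
    (hrow : ∀ i j, i ≠ 2 → j ≠ 2 → ∀ c c', z i 0 c * z j 1 c' - z i 1 c * z j 0 c' = 0)
    (hcol : ∀ i j, i ≠ 1 → j ≠ 1 → ∀ r r', z i r 0 * z j r' 1 - z i r 1 * z j r' 0 = 0) :
    MinorsVanish ladderRow ladderCol (entries z) := by
  have hrow' : ∀ i j, i ≠ 2 → j ≠ 2 → ∀ r r' c c', z i r c * z j r' c' = z j r c' * z i r' c := by
    intro i j hi hj r r' c c'
    have := hrow i j hi hj c c'
    fin_cases r <;> fin_cases r' <;> simp <;> grind
  have hcol' : ∀ i j, i ≠ 1 → j ≠ 1 → ∀ r r' c c', z i r c * z j r' c' = z i r c' * z j r' c := by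
    intro i j hi hj r r' c c'
    have := hcol i j hi hj r r'
    fin_cases c <;> fin_cases c' <;> simp <;> grind
  rintro ⟨i₁, r₁, c₁⟩ ⟨i₂, r₂, c₂⟩ ⟨i₃, r₃, c₃⟩ ⟨i₄, r₄, c₄⟩ h₁ h₂ h₃ h₄
  simp only [ladderRow, ladderCol, Prod.mk.injEq, decide_eq_decide] at h₁ h₂ h₃ h₄
  obtain ⟨h₁, rfl⟩ := h₁
  obtain ⟨h₂, rfl⟩ := h₂
  obtain ⟨h₃, rfl⟩ := h₃
  obtain ⟨h₄, rfl⟩ := h₄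
  simp only [entries]
  by_cases hi : i₁ ≠ 2 ∧ i₂ ≠ 2
  · obtain rfl : i₃ = i₂ := by omega
    obtain rfl : i₄ = i₁ := by omega
    exact hrow' _ _ hi.1 hi.2 _ _ _ _
  · obtain rfl : i₃ = i₁ := by omega
    obtain rfl : i₄ = i₂ := by omega
    exact hcol' _ _ (by omega) (by omega) _ _ _ _

/-- Matrices `k_i`, `k_j` with parallel columns and `k_l`, `k_m` with parallel rows and total sum
zero give a block matrix `(k_i + k_j, k_i; k_l, *)` whose minors vanish. -/
theorem minorsVanish_ladder_of_sum_eq_zero {C : Type*} [CommRing C]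
    {k : Fin 4 → Matrix (Fin 2) (Fin 2) C} {i j l m : Fin 4}
    (kp : ∀ a ∈ ({i, j} : Finset (Fin 4)), ∀ b ∈ ({i, j} : Finset (Fin 4)), ∀ c c',
      k a 0 c * k b 1 c' - k a 1 c * k b 0 c' = 0)
    (km : ∀ a ∈ ({l, m} : Finset (Fin 4)), ∀ b ∈ ({l, m} : Finset (Fin 4)), ∀ r r',
      k a r 0 * k b r' 1 - k a r 1 * k b r' 0 = 0)
    (hk : k i + k j = -(k l + k m)) {z : Fin 3 → Matrix (Fin 2) (Fin 2) C}
    (h0 : z 0 = k i + k j) (h1 : z 1 = k i) (h2 : z 2 = k l) :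
    MinorsVanish ladderRow ladderCol (entries z) := by
  refine minorsVanish_ladder ?_ ?_
  · intro a b ha hb c c'
    have e1 := kp i (by simp) i (by simp) c c'
    have e2 := kp i (by simp) j (by simp) c c'
    have e3 := kp j (by simp) i (by simp) c c'
    have e4 := kp j (by simp) j (by simp) c c'
    have ha' : a = 0 ∨ a = 1 := by omega
    have hb' : b = 0 ∨ b = 1 := by omega
    rcases ha' with rfl | rfl <;> rcases hb' with rfl | rfl <;>
      simp only [h0, h1, Matrix.add_apply]
    · linear_combination e1 + e2 + e3 + e4
    · linear_combination e1 + e3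
    · linear_combination e1 + e2
    · linear_combination e1
  · intro a b ha hb c c'
    have e1 := km l (by simp) l (by simp) c c'
    have e2 := km l (by simp) m (by simp) c c'
    have e3 := km m (by simp) l (by simp) c c'
    have e4 := km m (by simp) m (by simp) c c'
    have ha' : a = 0 ∨ a = 2 := by omega
    have hb' : b = 0 ∨ b = 2 := by omega
    rw [hk] at h0
    rcases ha' with rfl | rfl <;> rcases hb' with rfl | rfl <;>
      simp only [h0, h2, Matrix.add_apply, Matrix.neg_apply]
    · linear_combination e1 + e2 + e3 + e4
    · linear_combination -e1 - e3
    · linear_combination -e1 - e2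
    · linear_combination e1

/-- The converse of `minorsVanish_ladder_of_sum_eq_zero`. -/
theorem minors_of_ladder {C : Type*} [CommRing C] {s : Fin 3 → Matrix (Fin 2) (Fin 2) C}
    (hrow : ∀ i j, i ≠ 2 → j ≠ 2 → ∀ c c', s i 0 c * s j 1 c' - s i 1 c * s j 0 c' = 0)
    (hcol : ∀ i j, i ≠ 1 → j ≠ 1 → ∀ r r', s i r 0 * s j r' 1 - s i r 1 * s j r' 0 = 0)
    {y₁ y₂ y₃ y₄ : Matrix (Fin 2) (Fin 2) C} (h₁ : y₁ = s 1) (h₂ : y₂ = s 0 - s 1) (h₃ : y₃ = s 2)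
    (h₄ : y₄ = -(s 0 + s 2)) :
    (y₁.det = 0 ∧ y₂.det = 0 ∧ y₃.det = 0 ∧ y₄.det = 0) ∧
      (∀ c c', y₁ 0 c * y₂ 1 c' - y₁ 1 c * y₂ 0 c' = 0) ∧
      (∀ r r', y₃ r 0 * y₄ r' 1 - y₃ r 1 * y₄ r' 0 = 0) := by
  have h00 := hrow 0 0 (by decide) (by decide)
  have h01 := hrow 0 1 (by decide) (by decide)
  have h10 := hrow 1 0 (by decide) (by decide)
  have h11 := hrow 1 1 (by decide) (by decide)
  have g00 := hcol 0 0 (by decide) (by decide)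
  have g02 := hcol 0 2 (by decide) (by decide)
  have g20 := hcol 2 0 (by decide) (by decide)
  have g22 := hcol 2 2 (by decide) (by decide)
  subst h₁ h₂ h₃ h₄
  simp only [Matrix.det_fin_two, Matrix.sub_apply, Matrix.neg_apply, Matrix.add_apply]
  refine ⟨⟨?_, ?_, ?_, ?_⟩, fun c c' => ?_, fun r r' => ?_⟩
  · linear_combination h11 0 1
  · linear_combination h00 0 1 + h11 0 1 - h01 0 1 - h10 0 1
  · linear_combination g22 0 1
  · linear_combination g00 0 1 + g22 0 1 + g02 0 1 + g20 0 1
  · linear_combination h10 c c' - h11 c c'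
  · linear_combination -g20 r r' - g22 r r'

/-- There is a universal domain with a partial block matrix `(k₀ k₁; k₂ *)` all of whose minors
vanish. -/
theorem exists_ladder_domain : ∃ (D : Type) (_ : CommRing D) (_ : Algebra ℂ D) (_ : IsDomain D)
    (s : Fin 3 → Matrix (Fin 2) (Fin 2) D),
    (∀ i j, i ≠ 2 → j ≠ 2 → ∀ c c', s i 0 c * s j 1 c' - s i 1 c * s j 0 c' = 0) ∧
    (∀ i j, i ≠ 1 → j ≠ 1 → ∀ r r', s i r 0 * s j r' 1 - s i r 1 * s j r' 0 = 0) ∧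
    ∀ (C : Type) [CommRing C] [Algebra ℂ C] (z : Fin 3 → Matrix (Fin 2) (Fin 2) C),
      MinorsVanish ladderRow ladderCol (entries z) →
      ∃ h : D →ₐ[ℂ] C, ∀ n r c, h (s n r c) = z n r c := by
  refine ⟨EdgeRing ladderRow ladderCol ℂ, inferInstance, inferInstance, inferInstance,
    fun n => Matrix.of fun r c => edgeVar ladderRow ladderCol ℂ (n, r, c), ?_, ?_, ?_⟩
  · intro a b ha hb c c'
    rw [sub_eq_zero, mul_comm (Matrix.of _ 1 c)]
    exact minorsVanish_edgeVar ladderRow ladderCol ℂ (a, 0, c) (b, 1, c') (b, 0, c') (a, 1, c)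
      (by simp [ladderRow, ha, hb]) (by simp [ladderCol]) (by simp [ladderRow, ha, hb])
      (by simp [ladderCol])
  · intro a b ha hb r r'
    rw [sub_eq_zero]
    exact minorsVanish_edgeVar ladderRow ladderCol ℂ (a, r, 0) (b, r', 1) (a, r, 1) (b, r', 0)
      (by simp [ladderRow]) (by simp [ladderCol, ha, hb]) (by simp [ladderRow])
      (by simp [ladderCol, ha, hb])
  · intro C _ _ z hz
    exact ⟨edgeLift isNested_ladder hz, fun n r c => edgeLift_edgeVar isNested_ladder hz (n, r, c)⟩

/-- The points of the ideal are `k_i = P₁`, `k_j = P - P₁`, `k_l = P₂`, `k_m = -P - P₂`, where the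
block row `(P P₁)` and the block column `(P; P₂)` have rank at most one. -/
theorem sup_isPrime {i j l m : Fin 4} (hij : i ≠ j) (hlm : l ≠ m)
    (hS : ({i, j} : Finset (Fin 4))ᶜ = {l, m}) :
    (minorsPlus {i, j} ⊔ minorsMinus {l, m}).IsPrime := by
  obtain ⟨D, _, _, _, s, hrow, hcol, huniv⟩ := exists_ladder_domain
  have hmem (x : Fin 4) : x = i ∨ x = j ∨ x = l ∨ x = m := by
    have := Finset.mem_compl (s := {i, j}) (a := x)
    rw [hS] at this
    simp only [Finset.mem_insert, Finset.mem_singleton] at this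
    tauto
  have hl : l ≠ i ∧ l ≠ j := by
    have : l ∈ ({i, j} : Finset (Fin 4))ᶜ := by simp [hS]
    simpa using this
  have hm : m ≠ i ∧ m ≠ j := by
    have : m ∈ ({i, j} : Finset (Fin 4))ᶜ := by simp [hS]
    simpa using this
  let y : Fin 4 → Matrix (Fin 2) (Fin 2) D := fun x =>
    if x = i then s 1 else if x = j then s 0 - s 1 else if x = l then s 2 else -(s 0 + s 2)
  have hyi : y i = s 1 := by simp [y]
  have hyj : y j = s 0 - s 1 := by simp [y, hij.symm]
  have hyl : y l = s 2 := by simp [y, hl]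
  have hym : y m = -(s 0 + s 2) := by simp [y, hm, hlm.symm]
  obtain ⟨⟨d₁, d₂, d₃, d₄⟩, hp, hm'⟩ := minors_of_ladder hrow hcol hyi hyj hyl hym
  have hy (x) : (y x).det = 0 := by
    rcases hmem x with rfl | rfl | rfl | rfl <;> assumption
  have hsum : ∑ x, y x = 0 := by
    rw [sum_eq_of_compl_eq hij hlm hS, hyi, hyj, hyl, hym]
    abel
  set I := minorsPlus {i, j} ⊔ minorsMinus {l, m} with hI
  have hIp := minorsPlus_le_iff.1 (le_sup_left : minorsPlus {i, j} ≤ I)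
  have hIm := minorsMinus_le_iff.1 (le_sup_right : minorsMinus {l, m} ≤ I)
  let k : Fin 4 → Matrix (Fin 2) (Fin 2) (MomentaRing 4 ⧸ I) :=
    fun x => (momentum x).map (Ideal.Quotient.mk I)
  have kp (a) (ha : a ∈ ({i, j} : Finset (Fin 4))) (b) (hb : b ∈ ({i, j} : Finset (Fin 4)))
      (c c') :
      k a 0 c * k b 1 c' - k a 1 c * k b 0 c' = 0 := by
    simp only [k, Matrix.map_apply]
    rw [← map_mul, ← map_mul, ← map_sub]
    exact Ideal.Quotient.eq_zero_iff_mem.2 (hIp a ha b hb c c')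
  have km (a) (ha : a ∈ ({l, m} : Finset (Fin 4))) (b) (hb : b ∈ ({l, m} : Finset (Fin 4)))
      (r r') :
      k a r 0 * k b r' 1 - k a r 1 * k b r' 0 = 0 := by
    simp only [k, Matrix.map_apply]
    rw [← map_mul, ← map_mul, ← map_sub]
    exact Ideal.Quotient.eq_zero_iff_mem.2 (hIm a ha b hb r r')
  have hk : k i + k j = -(k l + k m) := by
    rw [eq_neg_iff_add_eq_zero, ← sum_eq_of_compl_eq hij hlm hS k,
      sum_mk_map_momentum, sum_momentum]
    ext r c
    simp
  have hk' (r c) : k i r c + k j r c = -(k l r c + k m r c) := congrFun (congrFun hk r) c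
  let z : Fin 3 → Matrix (Fin 2) (Fin 2) (MomentaRing 4 ⧸ I) := ![k i + k j, k i, k l]
  obtain ⟨h, hh⟩ := huniv _ z
    (minorsVanish_ladder_of_sum_eq_zero (C := MomentaRing 4 ⧸ I) kp km hk rfl rfl rfl)
  refine isPrime_of_factor y hy hsum ?_ h fun x r c => ?_
  · rw [hI, sup_le_iff, minorsPlus_pair_le_iff, minorsMinus_pair_le_iff]
    constructor
    · intro c c'
      rw [RingHom.mem_ker, map_sub, map_mul, map_mul]
      simp only [momentaLift_momentum]
      exact hp c c'
    · intro r r'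
      rw [RingHom.mem_ker, map_sub, map_mul, map_mul]
      simp only [momentaLift_momentum]
      exact hm' r r'
  · change h (y x r c) = k x r c
    rcases hmem x with hx | hx | hx | hx <;> rw [hx]
    · rw [hyi, hh]; rfl
    · rw [hyj, Matrix.sub_apply, map_sub, hh, hh]
      exact add_sub_cancel_left (k i r c) (k j r c)
    · rw [hyl, hh]; rfl
    · rw [hym, Matrix.neg_apply, Matrix.add_apply, map_neg, map_add, hh, hh]
      change -(k i r c + k j r c + k l r c) = k m r c
      rw [hk' r c, neg_add_rev, neg_neg, neg_add_cancel_left]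

end Four

/-! ### Primes over `Q_J` for four momenta -/

section FourClassification

/-- The entries of `p` annihilate, modulo `q`, the determinant of two vectors that are parallel
to `p` modulo `q`. -/
theorem minor_pair_smul {A : Type*} [CommRing A] {q : Ideal A} {p x y : Fin 2 → A}
    (hx : p 0 * x 1 - p 1 * x 0 ∈ q) (hy : p 0 * y 1 - p 1 * y 0 ∈ q) (r : Fin 2) :
    p r * (x 0 * y 1 - x 1 * y 0) ∈ q := by
  fin_cases r
  · convert q.sub_mem (q.mul_mem_left (x 0) hy) (q.mul_mem_left (y 0) hx) using 1
    simp only [Fin.zero_eta]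
    ring
  · convert q.sub_mem (q.mul_mem_left (x 1) hy) (q.mul_mem_left (y 1) hx) using 1
    simp only [Fin.mk_one]
    ring

/-- If the columns of `k_i`, `k_j` are parallel and so are those of `k_l`, `k_m`, then all columns
are parallel to those of `k_i + k_j = -(k_l + k_m)`, unless this matrix vanishes; in the latter case
`k_m = -k_l`. -/
theorem minorsPlus_univ_le_or {i j l m : Fin 4} (hij : i ≠ j) (hlm : l ≠ m)
    (hS : ({i, j} : Finset (Fin 4))ᶜ = {l, m}) {q : Ideal (MomentaRing 4)} (hq : q.IsPrime)
    (h₁ : minorsPlus {i, j} ≤ q) (h₂ : minorsPlus {l, m} ≤ q) :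
    minorsPlus Finset.univ ≤ q ∨ minorsMinus {l, m} ≤ q := by
  have hsum (r c : Fin 2) : momentum i r c + momentum j r c =
      -(momentum l r c + momentum m r c) := by
    rw [eq_neg_iff_add_eq_zero]
    have := congrFun (congrFun (sum_momentum (N := 4)) r) c
    rw [sum_eq_of_compl_eq hij hlm hS] at this
    exact this
  by_cases hP : ∀ r c : Fin 2, momentum l r c + momentum m r c ∈ q
  · right
    rw [minorsMinus_pair_le_iff]
    intro r r'
    have h0 := minor_self ((Matrix.det_transpose _).trans (det_momentum l)) r r'
    simp only [Matrix.transpose_apply] at h0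
    convert q.sub_mem (q.mul_mem_left (momentum l r 0) (hP r' 1))
      (q.mul_mem_left (momentum l r 1) (hP r' 0)) using 1
    linear_combination -h0
  · left
    push Not at hP
    obtain ⟨r, c, hrc⟩ := hP
    rw [minorsPlus_le_iff] at h₁ h₂
    let P : Fin 2 → MomentaRing 4 := fun r => momentum l r c + momentum m r c
    have key (a : Fin 4) (c' : Fin 2) : P 0 * momentum a 1 c' - P 1 * momentum a 0 c' ∈ q := by
      by_cases ha : a ∈ ({i, j} : Finset (Fin 4))
      · convert q.neg_mem (q.add_mem (h₁ i (by simp) a ha c c') (h₁ j (by simp) a ha c c')) using 1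
        simp only [P]
        linear_combination momentum a 1 c' * hsum 0 c - momentum a 0 c' * hsum 1 c
      · rw [← Finset.mem_compl, hS] at ha
        convert q.add_mem (h₂ l (by simp) a ha c c') (h₂ m (by simp) a ha c c') using 1
        simp only [P]
        ring
    rw [minorsPlus_le_iff]
    intro a _ b _ c₁ c₂
    exact (hq.mem_or_mem (minor_pair_smul (p := P) (x := fun r => momentum a r c₁)
      (y := fun r => momentum b r c₂) (key a c₁) (key b c₂) r)).resolve_left hrc

theorem mixedIdeal_of_compl {S T : Finset (Fin 4)} (h : Sᶜ = T) :
    mixedIdeal S = minorsPlus S ⊔ minorsMinus T := by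
  rw [mixedIdeal_eq_sup, h]

theorem exists_pair_compl {S : Finset (Fin 4)} (hS : S.card = 2) :
    ∃ i j l m : Fin 4, i ≠ j ∧ l ≠ m ∧ S = {i, j} ∧ ({i, j} : Finset (Fin 4))ᶜ = {l, m} := by
  obtain ⟨i, j, hij, rfl⟩ := Finset.card_eq_two.1 hS
  obtain ⟨l, m, hlm, h⟩ := Finset.card_eq_two.1
    (show ({i, j} : Finset (Fin 4))ᶜ.card = 2 by rw [Finset.card_compl, hS, Fintype.card_fin])
  exact ⟨i, j, l, m, hij, hlm, rfl, h⟩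

theorem mixedIdeal_isPrime {S : Finset (Fin 4)} (hS : S.card = 2) : (mixedIdeal S).IsPrime := by
  obtain ⟨i, j, l, m, hij, hlm, rfl, h⟩ := exists_pair_compl hS
  rw [mixedIdeal_of_compl h]
  exact sup_isPrime hij hlm h

theorem minorsPlus_mono {N : ℕ} {S T : Finset (Fin N)} (h : S ⊆ T) :
    minorsPlus S ≤ minorsPlus T := by
  rw [minorsPlus_le_iff]
  intro i hi j hj
  exact minorsPlus_le_iff.1 le_rfl i (h hi) j (h hj)

theorem minorsMinus_mono {N : ℕ} {S T : Finset (Fin N)} (h : S ⊆ T) :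
    minorsMinus S ≤ minorsMinus T := by
  rw [minorsMinus_le_iff]
  intro i hi j hj
  exact minorsMinus_le_iff.1 le_rfl i (h hi) j (h hj)

theorem exists_le_of_idealQ_le {S : Finset (Fin 4)} (hS : S.card = 2) {q : Ideal (MomentaRing 4)}
    (hq : q.IsPrime) (h : idealQ S ≤ q) : minorsPlus Finset.univ ≤ q ∨ minorsMinus Finset.univ ≤ q ∨
      mixedIdeal S ≤ q ∨ mixedIdeal Sᶜ ≤ q := by
  obtain ⟨i, j, l, m, hij, hlm, rfl, hc⟩ := exists_pair_compl hS
  have hc' : ({l, m} : Finset (Fin 4))ᶜ = {i, j} := by rw [← hc, compl_compl]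
  rw [hc, mixedIdeal_of_compl hc, mixedIdeal_of_compl hc', sup_le_iff, sup_le_iff]
  rcases minorsPlus_le_or_minorsMinus_le hij hq h with h₁ | h₁ <;>
    rcases minorsPlus_le_or_minorsMinus_le hlm hq (by rwa [← hc, idealQ_compl]) with h₂ | h₂
  · rcases minorsPlus_univ_le_or hij hlm hc hq h₁ h₂ with h₃ | h₃
    · exact Or.inl h₃
    · exact Or.inr (Or.inr (Or.inl ⟨h₁, h₃⟩))
  · exact Or.inr (Or.inr (Or.inl ⟨h₁, h₂⟩))
  · exact Or.inr (Or.inr (Or.inr ⟨h₂, h₁⟩))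
  · -- this is the first case transposed
    rw [minorsMinus_eq_comap, comap_transposition_le_iff] at h₁ h₂
    rcases minorsPlus_univ_le_or hij hlm hc (Ideal.comap_isPrime _ _) h₁ h₂ with h₃ | h₃
    · rw [← comap_transposition_le_iff, ← minorsMinus_eq_comap] at h₃
      exact Or.inr (Or.inl h₃)
    · rw [← comap_transposition_le_iff, ← minorsPlus_eq_comap] at h₃
      rw [← comap_transposition_le_iff, ← minorsMinus_eq_comap] at h₁
      exact Or.inr (Or.inr (Or.inr ⟨h₃, h₁⟩))

/-- All matrices of the point are supported on the first row, and these rows are pairwise linearly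
independent. -/
theorem exists_point_plus : ∃ e : MomentaRing 4 →ₐ[ℂ] ℂ,
    minorsPlus Finset.univ ≤ RingHom.ker e ∧
      ∀ a b : Fin 4, a ≠ b → ¬ minorsMinus {a, b} ≤ RingHom.ker e := by
  let u : Fin 4 → ℂ := ![1, 0, 1, -2]
  let w : Fin 4 → ℂ := ![0, 1, 2, -3]
  let y : Fin 4 → Matrix (Fin 2) (Fin 2) ℂ := fun i => !![u i, w i; 0, 0]
  have hy (i) : (y i).det = 0 := by simp [y, Matrix.det_fin_two]
  have hs : ∑ i, y i = 0 := by
    ext r c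
    fin_cases r <;> fin_cases c <;> simp [y, u, w, Fin.sum_univ_four] <;> norm_num
  refine ⟨momentaLift y hy hs, ?_, fun a b hab h => ?_⟩
  · rw [minorsPlus_le_iff]
    intro i _ j _ c c'
    rw [RingHom.mem_ker, map_sub, map_mul, map_mul]
    simp only [momentaLift_momentum]
    fin_cases c <;> fin_cases c' <;> simp [y]
  · have := minorsMinus_pair_le_iff.1 h 0 0
    rw [RingHom.mem_ker, map_sub, map_mul, map_mul] at this
    simp only [momentaLift_momentum] at this
    have h' : u a * w b - w a * u b = 0 := this
    fin_cases a <;> fin_cases b <;> first | exact hab rfl | (norm_num [u, w] at h')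

/-- The transpose of the point in `exists_point_plus`. -/
theorem exists_point_minus : ∃ e : MomentaRing 4 →ₐ[ℂ] ℂ,
    minorsMinus Finset.univ ≤ RingHom.ker e ∧
      ∀ a b : Fin 4, a ≠ b → ¬ minorsPlus {a, b} ≤ RingHom.ker e := by
  obtain ⟨e, h₁, h₂⟩ := exists_point_plus
  refine ⟨e.comp transposition, ?_, fun a b hab h => h₂ a b hab ?_⟩
  · rw [minorsMinus_eq_comap, comap_transposition_le_iff]
    intro x hx
    have := h₁ hx
    rw [RingHom.mem_ker] at this
    simpa [RingHom.mem_ker, transposition_transposition] using this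
  · rw [minorsMinus_eq_comap, comap_transposition_le_iff]
    intro x hx
    exact h hx

/-- The point consists of two matrices supported on the first row and two supported on the first
column; only the first pair has parallel columns, and only the second has parallel rows. -/
theorem exists_point_mixed {S : Finset (Fin 4)} (hS : S.card = 2) :
    ∃ e : MomentaRing 4 →ₐ[ℂ] ℂ, mixedIdeal S ≤ RingHom.ker e ∧
      (∀ a b : Fin 4, a ≠ b → minorsPlus {a, b} ≤ RingHom.ker e → {a, b} = S) ∧
      ∀ a b : Fin 4, a ≠ b → minorsMinus {a, b} ≤ RingHom.ker e → {a, b} = Sᶜ := by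
  obtain ⟨i, j, l, m, hij, hlm, rfl, hc⟩ := exists_pair_compl hS
  have hmem (x : Fin 4) : x = i ∨ x = j ∨ x = l ∨ x = m := by
    have := Finset.mem_compl (s := {i, j}) (a := x)
    rw [hc] at this
    simp only [Finset.mem_insert, Finset.mem_singleton] at this
    tauto
  have hl : l ≠ i ∧ l ≠ j := by
    have : l ∈ ({i, j} : Finset (Fin 4))ᶜ := by simp [hc]
    simpa using this
  have hm : m ≠ i ∧ m ≠ j := by
    have : m ∈ ({i, j} : Finset (Fin 4))ᶜ := by simp [hc]
    simpa using this
  let y : Fin 4 → Matrix (Fin 2) (Fin 2) ℂ := fun x =>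
    if x = i then !![1, 1; 0, 0] else if x = j then !![0, -1; 0, 0]
      else if x = l then !![1, 0; 1, 0] else !![-2, 0; -1, 0]
  have hyi : y i = !![1, 1; 0, 0] := by simp [y]
  have hyj : y j = !![0, -1; 0, 0] := by simp [y, hij.symm]
  have hyl : y l = !![1, 0; 1, 0] := by simp [y, hl]
  have hym : y m = !![-2, 0; -1, 0] := by simp [y, hm, hlm.symm]
  have hy (x) : (y x).det = 0 := by
    rcases hmem x with hx | hx | hx | hx <;> rw [hx] <;>
      simp [hyi, hyj, hyl, hym, Matrix.det_fin_two]
  have hs : ∑ x, y x = 0 := by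
    rw [sum_eq_of_compl_eq hij hlm hc, hyi, hyj, hyl, hym]
    ext r c
    fin_cases r <;> fin_cases c <;> (simp; try norm_num)
  refine ⟨momentaLift y hy hs, ?_, fun a b hab h => ?_, fun a b hab h => ?_⟩
  · rw [mixedIdeal_of_compl hc, sup_le_iff, minorsPlus_pair_le_iff, minorsMinus_pair_le_iff]
    constructor
    · intro c c'
      rw [RingHom.mem_ker, map_sub, map_mul, map_mul]
      simp only [momentaLift_momentum, hyi, hyj]
      fin_cases c <;> fin_cases c' <;> simp
    · intro c c'
      rw [RingHom.mem_ker, map_sub, map_mul, map_mul]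
      simp only [momentaLift_momentum, hyl, hym]
      fin_cases c <;> fin_cases c' <;> simp
  · have h' (c c' : Fin 2) : y a 0 c * y b 1 c' - y a 1 c * y b 0 c' = 0 := by
      have := minorsPlus_pair_le_iff.1 h c c'
      rw [RingHom.mem_ker, map_sub, map_mul, map_mul] at this
      simpa only [momentaLift_momentum] using this
    have h00 := h' 0 0
    have h01 := h' 0 1
    have h10 := h' 1 0
    rcases hmem a with ha | ha | ha | ha <;> rcases hmem b with hb | hb | hb | hb <;>
      rw [ha, hb] at hab h00 h01 h10 ⊢ <;>
      first
        | exact absurd rfl hab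
        | rfl
        | exact Finset.pair_comm _ _
        | (exfalso; simp only [hyi, hyj, hyl, hym] at h00 h01 h10
           first
           | (norm_num at h00; done)
           | (norm_num at h01; done)
           | norm_num at h10)
  · have h' (c c' : Fin 2) : y a c 0 * y b c' 1 - y a c 1 * y b c' 0 = 0 := by
      have := minorsMinus_pair_le_iff.1 h c c'
      rw [RingHom.mem_ker, map_sub, map_mul, map_mul] at this
      simpa only [momentaLift_momentum] using this
    have h00 := h' 0 0
    rw [hc]
    rcases hmem a with ha | ha | ha | ha <;> rcases hmem b with hb | hb | hb | hb <;>
      rw [ha, hb] at hab h00 ⊢ <;>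
      first
        | exact absurd rfl hab
        | rfl
        | exact Finset.pair_comm _ _
        | (exfalso; simp only [hyi, hyj, hyl, hym] at h00; norm_num at h00)

end FourClassification

/-! ### The classification for four momenta -/

section MinimalPrimes

theorem minimalPrimes_eq_of_antichain {A : Type*} [CommRing A] {I : Ideal A} {P : Set (Ideal A)}
    (hprime : ∀ p ∈ P, p.IsPrime) (hle : ∀ p ∈ P, I ≤ p)
    (hcover : ∀ q : Ideal A, q.IsPrime → I ≤ q → ∃ p ∈ P, p ≤ q)
    (hanti : ∀ p ∈ P, ∀ q ∈ P, p ≤ q → p = q) : I.minimalPrimes = P := by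
  ext p
  constructor
  · rintro ⟨⟨hp, hI⟩, hmin⟩
    obtain ⟨q, hq, hqp⟩ := hcover p hp hI
    have := hmin ⟨hprime q hq, hle q hq⟩ hqp
    rwa [le_antisymm this hqp]
  · intro hp
    refine ⟨⟨hprime p hp, hle p hp⟩, fun q ⟨hq, hI⟩ hqp => ?_⟩
    obtain ⟨p', hp', hle'⟩ := hcover q hq hI
    rw [hanti p' hp' p hp (hle'.trans hqp)] at hle'
    exact hle'

/-- The primes `𝔭_{++++}`, `𝔭_{----}` and `𝔭_S`, as a set of ideals. -/
def fourPrimes : Set (Ideal (MomentaRing 4)) :=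
  {minorsPlus Finset.univ, minorsMinus Finset.univ} ∪
    {p | ∃ S : Finset (Fin 4), S.card = 2 ∧ p = mixedIdeal S}

theorem minorsPlus_univ_not_le_mixedIdeal {S : Finset (Fin 4)} (hS : S.card = 2) :
    ¬ minorsPlus Finset.univ ≤ mixedIdeal S := by
  intro h
  obtain ⟨e, h₁, h₂, -⟩ := exists_point_mixed hS
  have hp (a b : Fin 4) (hab : a ≠ b) := h₂ a b hab
    ((minorsPlus_mono (Finset.subset_univ _)).trans (h.trans h₁))
  have := (hp 0 1 (by decide)).trans (hp 0 2 (by decide)).symm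
  exact absurd this (by decide)

theorem minorsMinus_univ_not_le_mixedIdeal {S : Finset (Fin 4)} (hS : S.card = 2) :
    ¬ minorsMinus Finset.univ ≤ mixedIdeal S := by
  intro h
  obtain ⟨e, h₁, -, h₂⟩ := exists_point_mixed hS
  have hp (a b : Fin 4) (hab : a ≠ b) := h₂ a b hab
    ((minorsMinus_mono (Finset.subset_univ _)).trans (h.trans h₁))
  have := (hp 0 1 (by decide)).trans (hp 0 2 (by decide)).symm
  exact absurd this (by decide)

theorem mixedIdeal_le_mixedIdeal {S T : Finset (Fin 4)} (hS : S.card = 2) (hT : T.card = 2)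
    (h : mixedIdeal S ≤ mixedIdeal T) : S = T := by
  obtain ⟨e, h₁, h₂, -⟩ := exists_point_mixed hT
  obtain ⟨i, j, hij, rfl⟩ := Finset.card_eq_two.1 hS
  rw [mixedIdeal_eq_sup {i, j}] at h
  exact h₂ i j hij (le_sup_left.trans (h.trans h₁))

theorem mixedIdeal_not_le_minorsPlus {S : Finset (Fin 4)} (hS : S.card = 2) :
    ¬ mixedIdeal S ≤ minorsPlus Finset.univ := by
  intro h
  obtain ⟨e, h₁, h₂⟩ := exists_point_plus
  obtain ⟨i, j, l, m, hij, hlm, rfl, hc⟩ := exists_pair_compl hS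
  rw [mixedIdeal_of_compl hc] at h
  exact h₂ l m hlm (le_sup_right.trans (h.trans h₁))

theorem mixedIdeal_not_le_minorsMinus {S : Finset (Fin 4)} (hS : S.card = 2) :
    ¬ mixedIdeal S ≤ minorsMinus Finset.univ := by
  intro h
  obtain ⟨e, h₁, h₂⟩ := exists_point_minus
  obtain ⟨i, j, l, m, hij, hlm, rfl, hc⟩ := exists_pair_compl hS
  rw [mixedIdeal_of_compl hc] at h
  exact h₂ i j hij (le_sup_left.trans (h.trans h₁))

theorem minorsPlus_univ_not_le_minorsMinus :
    ¬ minorsPlus (Finset.univ : Finset (Fin 4)) ≤ minorsMinus Finset.univ := by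
  intro h
  obtain ⟨e, h₁, h₂⟩ := exists_point_minus
  exact h₂ 0 1 (by decide) ((minorsPlus_mono (Finset.subset_univ _)).trans (h.trans h₁))

theorem minorsMinus_univ_not_le_minorsPlus :
    ¬ minorsMinus (Finset.univ : Finset (Fin 4)) ≤ minorsPlus Finset.univ := by
  intro h
  obtain ⟨e, h₁, h₂⟩ := exists_point_plus
  exact h₂ 0 1 (by decide) ((minorsMinus_mono (Finset.subset_univ _)).trans (h.trans h₁))

theorem fourPrimes_antichain : ∀ p ∈ fourPrimes, ∀ q ∈ fourPrimes, p ≤ q → p = q := by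
  rintro p ((rfl | rfl) | ⟨S, hS, rfl⟩) q ((rfl | rfl) | ⟨T, hT, rfl⟩) h
  · rfl
  · exact absurd h minorsPlus_univ_not_le_minorsMinus
  · exact absurd h (minorsPlus_univ_not_le_mixedIdeal hT)
  · exact absurd h minorsMinus_univ_not_le_minorsPlus
  · rfl
  · exact absurd h (minorsMinus_univ_not_le_mixedIdeal hT)
  · exact absurd h (mixedIdeal_not_le_minorsPlus hS)
  · exact absurd h (mixedIdeal_not_le_minorsMinus hS)
  · rw [mixedIdeal_le_mixedIdeal hS hT h]

theorem isInternal_four_iff {J : Finset (Fin 4)} : IsInternal J ↔ J.card = 2 := by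
  unfold IsInternal
  omega

theorem card_compl_four {J : Finset (Fin 4)} (hJ : J.card = 2) : Jᶜ.card = 2 := by
  rw [Finset.card_compl, hJ, Fintype.card_fin]

theorem idealQ_le_mixedIdeal {J : Finset (Fin 4)} (hJ : J.card = 2) : idealQ J ≤ mixedIdeal J := by
  rw [mixedIdeal_eq_sup]
  obtain ⟨i, j, hij, rfl⟩ := Finset.card_eq_two.1 hJ
  exact (idealQ_pair_le_minorsPlus hij).trans le_sup_left

theorem minimalPrimes_idealQ_four {J : Finset (Fin 4)} (hJ : J.card = 2) :
    (idealQ J).minimalPrimes =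
      {minorsPlus Finset.univ, minorsMinus Finset.univ, mixedIdeal J, mixedIdeal Jᶜ} := by
  have hJ' := card_compl_four hJ
  refine minimalPrimes_eq_of_antichain ?_ ?_ ?_ ?_
  · rintro p (rfl | rfl | rfl | rfl)
    · exact minorsPlus_univ_isPrime
    · exact minorsMinus_isPrime minorsPlus_univ_isPrime
    · exact mixedIdeal_isPrime hJ
    · exact mixedIdeal_isPrime hJ'
  · rintro p (rfl | rfl | rfl | rfl)
    · obtain ⟨i, j, hij, rfl⟩ := Finset.card_eq_two.1 hJ
      exact (idealQ_pair_le_minorsPlus hij).trans (minorsPlus_mono (Finset.subset_univ _))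
    · obtain ⟨i, j, hij, rfl⟩ := Finset.card_eq_two.1 hJ
      exact (idealQ_pair_le_minorsMinus hij).trans (minorsMinus_mono (Finset.subset_univ _))
    · exact idealQ_le_mixedIdeal hJ
    · rw [← idealQ_compl]
      exact idealQ_le_mixedIdeal hJ'
  · intro q hq h
    rcases exists_le_of_idealQ_le hJ hq h with h | h | h | h <;> exact ⟨_, by simp, h⟩
  · have hsub : ({minorsPlus Finset.univ, minorsMinus Finset.univ, mixedIdeal J, mixedIdeal Jᶜ} :
        Set (Ideal (MomentaRing 4))) ⊆ fourPrimes := by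
      rintro p (rfl | rfl | rfl | rfl)
      · exact Or.inl (Or.inl rfl)
      · exact Or.inl (Or.inr rfl)
      · exact Or.inr ⟨J, hJ, rfl⟩
      · exact Or.inr ⟨Jᶜ, hJ', rfl⟩
    exact fun p hp q hq => fourPrimes_antichain p (hsub hp) q (hsub hq)

theorem primeDivisors_four : primeDivisors 4 = fourPrimes := by
  ext p
  constructor
  · rintro ⟨J, hJ, hp⟩
    rw [isInternal_four_iff] at hJ
    rw [minimalPrimes_idealQ_four hJ] at hp
    rcases hp with rfl | rfl | rfl | rfl
    · exact Or.inl (Or.inl rfl)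
    · exact Or.inl (Or.inr rfl)
    · exact Or.inr ⟨J, hJ, rfl⟩
    · exact Or.inr ⟨Jᶜ, card_compl_four hJ, rfl⟩
  · have h01 : ({0, 1} : Finset (Fin 4)).card = 2 := by decide
    rintro ((rfl | rfl) | ⟨S, hS, rfl⟩)
    · refine ⟨{0, 1}, isInternal_four_iff.2 h01, ?_⟩
      rw [minimalPrimes_idealQ_four h01]
      simp
    · refine ⟨{0, 1}, isInternal_four_iff.2 h01, ?_⟩
      rw [minimalPrimes_idealQ_four h01]
      simp
    · refine ⟨S, isInternal_four_iff.2 hS, ?_⟩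
      rw [minimalPrimes_idealQ_four hS]
      simp

theorem ncard_fourPrimes : fourPrimes.ncard = 8 := by
  have himage : {p | ∃ S : Finset (Fin 4), S.card = 2 ∧ p = mixedIdeal S} =
      mixedIdeal '' ((Finset.univ.powersetCard 2 : Finset (Finset (Fin 4))) : Set _) := by
    ext p
    simp only [Set.mem_ofPred_eq, Set.mem_image, Finset.mem_coe, Finset.mem_powersetCard_univ,
      eq_comm (a := p)]
  have hcard : {p | ∃ S : Finset (Fin 4), S.card = 2 ∧ p = mixedIdeal S}.ncard = 6 := by
    rw [himage, Set.InjOn.ncard_image, Set.ncard_coe_finset]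
    · rfl
    · intro S hS T hT h
      rw [Finset.mem_coe, Finset.mem_powersetCard_univ] at hS hT
      exact mixedIdeal_le_mixedIdeal hS hT h.le
  have hfin : {p | ∃ S : Finset (Fin 4), S.card = 2 ∧ p = mixedIdeal S}.Finite :=
    Set.finite_of_ncard_ne_zero (by rw [hcard]; decide)
  have hmp : minorsMinus Finset.univ ∉
      {p | ∃ S : Finset (Fin 4), S.card = 2 ∧ p = mixedIdeal S} := by
    rintro ⟨S, hS, h⟩
    exact minorsMinus_univ_not_le_mixedIdeal hS h.le
  have hpp : minorsPlus Finset.univ ∉ insert (minorsMinus Finset.univ)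
      {p | ∃ S : Finset (Fin 4), S.card = 2 ∧ p = mixedIdeal S} := by
    rintro (h | ⟨S, hS, h⟩)
    · exact minorsPlus_univ_not_le_minorsMinus h.le
    · exact minorsPlus_univ_not_le_mixedIdeal hS h.le
  rw [fourPrimes, Set.insert_union, Set.singleton_union,
    Set.ncard_insert_of_notMem hpp (hfin.insert _), Set.ncard_insert_of_notMem hmp hfin, hcard]

theorem mixedIdeal_mem_minimalPrimes_iff {S J : Finset (Fin 4)} (hS : S.card = 2)
    (hJ : J.card = 2) : mixedIdeal S ∈ (idealQ J).minimalPrimes ↔ J = S ∨ J = Sᶜ := by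
  rw [minimalPrimes_idealQ_four hJ]
  constructor
  · rintro (h | h | h | h)
    · exact absurd h.le (mixedIdeal_not_le_minorsPlus hS)
    · exact absurd h.le (mixedIdeal_not_le_minorsMinus hS)
    · exact Or.inl (mixedIdeal_le_mixedIdeal hS hJ h.le).symm
    · rw [mixedIdeal_le_mixedIdeal hS (card_compl_four hJ) (le_of_eq h), compl_compl]
      exact Or.inr rfl
  · rintro (rfl | rfl)
    · simp
    · simp

theorem zeroLocus_minorsPlus_univ :
    zeroLocus (minorsPlus (Finset.univ : Finset (Fin 4))) =
      {x | ∃ (v : Fin 2 → ℂ) (w : Fin 4 → Fin 2 → ℂ),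
        ∑ i, w i = 0 ∧ ∀ i, x i = Matrix.vecMulVec v (w i)} := by
  ext x
  constructor
  · intro hx
    have hs (r c : Fin 2) : ∑ i, x i r c = 0 := by
      have := hx (∑ i, MvPolynomial.X (i, r, c)) (by
        convert Ideal.zero_mem _
        rw [Ideal.Quotient.eq_zero_iff_mem]
        refine Ideal.subset_span (Or.inl ⟨(r, c), ?_⟩)
        simp [Matrix.sum_apply, polyMomentum])
      simpa using this
    have hm (i j : Fin 4) (r r' c c' : Fin 2) : x i r c * x j r' c' = x i r' c * x j r c' := by
      have h (c c' : Fin 2) := hx (MvPolynomial.X (i, 0, c) * MvPolynomial.X (j, 1, c') -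
        MvPolynomial.X (i, 1, c) * MvPolynomial.X (j, 0, c'))
        (minorsPlus_le_iff.1 le_rfl i (Finset.mem_univ i) j (Finset.mem_univ j) c c')
      have h1 := h c c'
      simp only [map_sub, map_mul, MvPolynomial.eval_X] at h1
      fin_cases r <;> fin_cases r' <;> simp only [Fin.zero_eta, Fin.mk_one]
      · linear_combination h1
      · linear_combination -h1
    by_cases h0 : ∀ i r c, x i r c = 0
    · refine ⟨0, 0, by simp, fun i => ?_⟩
      ext r c
      simp [h0]
    · push Not at h0
      obtain ⟨i₀, r₀, c₀, h0⟩ := h0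
      -- all columns are multiples of a nonzero one, normalised by its nonzero component
      refine ⟨fun r => x i₀ r c₀, fun i c => x i r₀ c / x i₀ r₀ c₀, ?_, fun i => ?_⟩
      · ext c
        simp only [Finset.sum_apply, Pi.zero_apply]
        rw [← Finset.sum_div, hs, zero_div]
      · ext r c
        rw [Matrix.vecMulVec_apply, mul_div_assoc', eq_div_iff h0, mul_comm]
        exact hm i₀ i r₀ r c₀ c
  · rintro ⟨v, w, hw, hx⟩ f hf
    have hd (i) : (x i).det = 0 := by
      rw [hx, Matrix.det_fin_two]
      simp only [Matrix.vecMulVec_apply]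
      ring
    have hs : ∑ i, x i = 0 := by
      ext r c
      have := congrFun hw c
      simp only [Finset.sum_apply, Pi.zero_apply] at this
      simp only [Matrix.sum_apply, hx, Matrix.vecMulVec_apply, Matrix.zero_apply]
      rw [← Finset.mul_sum, this, mul_zero]
    have hle : minorsPlus Finset.univ ≤ RingHom.ker (momentaLift x hd hs) := by
      rw [minorsPlus_le_iff]
      intro i _ j _ c c'
      rw [RingHom.mem_ker, map_sub, map_mul, map_mul]
      simp only [momentaLift_momentum, hx, Matrix.vecMulVec_apply]
      ring
    have := hle hf
    rw [RingHom.mem_ker, momentaLift_mk, MvPolynomial.aeval_eq_eval] at this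
    exact this

end MinimalPrimes

/-! ### Separating the loci `Q_J = 0` for at least five momenta -/

section Separation

variable {N : ℕ}

/-- The point of the momenta variety given by the diagonal matrices `diag (α_i, β_i)`. -/
def diagonalPoint (α β : Fin N → ℂ) (hαβ : ∀ i, α i * β i = 0) (hα : ∑ i, α i = 0)
    (hβ : ∑ i, β i = 0) : MomentaRing N →ₐ[ℂ] ℂ :=
  momentaLift (fun i => !![α i, 0; 0, β i]) (fun i => by simp [hαβ]) (by
    ext r c
    fin_cases r <;> fin_cases c <;> simp [Matrix.sum_apply, hα, hβ])

section

variable {α β : Fin N → ℂ} {hαβ : ∀ i, α i * β i = 0} {hα : ∑ i, α i = 0} {hβ : ∑ i, β i = 0}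

theorem diagonalPoint_Q (J : Finset (Fin N)) :
    diagonalPoint α β hαβ hα hβ (Q J) = (∑ i ∈ J, α i) * ∑ i ∈ J, β i := by
  simp [diagonalPoint, momentaLift_Q, Matrix.det_fin_two, Matrix.sum_apply]

theorem minors_pair_le_ker_diagonalPoint {i j : Fin N} (hij : i ≠ j)
    (h : ∑ x ∈ {i, j}, α x = 0) :
    minorsPlus {i, j} ≤ RingHom.ker (diagonalPoint α β hαβ hα hβ) ∧
      minorsMinus {i, j} ≤ RingHom.ker (diagonalPoint α β hαβ hα hβ) := by
  rw [Finset.sum_pair hij] at h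
  have h₁ : α i * β j = 0 := by linear_combination β j * h - hαβ j
  have h₂ : β i * α j = 0 := by linear_combination β i * h - hαβ i
  rw [minorsPlus_pair_le_iff, minorsMinus_pair_le_iff]
  constructor <;> intro c c' <;> rw [RingHom.mem_ker, map_sub, map_mul, map_mul] <;>
    simp only [diagonalPoint, momentaLift_momentum] <;>
    fin_cases c <;> fin_cases c' <;> simp [-mul_eq_zero, h₁, h₂]

end

/-- The point used here consists of three matrices supported on the first row, the rows of `k_i`
and `k_j` being linearly independent. -/
theorem exists_point_minorsPlus_pair (hN : 3 ≤ N) {i j : Fin N} (hij : i ≠ j) :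
    ∃ e : MomentaRing N →ₐ[ℂ] ℂ, minorsPlus {i, j} ≤ RingHom.ker e ∧
      ¬ minorsMinus {i, j} ≤ RingHom.ker e := by
  obtain ⟨l, hl⟩ : ∃ l, l ∉ ({i, j} : Finset (Fin N)) := by
    by_contra! h
    have := Finset.card_le_card (fun x _ => h x : (Finset.univ : Finset (Fin N)) ⊆ {i, j})
    rw [Finset.card_pair hij, Finset.card_univ, Fintype.card_fin] at this
    omega
  rw [Finset.mem_insert, Finset.mem_singleton, not_or] at hl
  let μ : Fin N → Fin 2 → ℂ := Pi.single i ![1, 0] + Pi.single j ![0, 1] - Pi.single l ![1, 1]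
  have hμi : μ i = ![1, 0] := by simp [μ, hij, Ne.symm hl.1]
  have hμj : μ j = ![0, 1] := by simp [μ, hij.symm, Ne.symm hl.2]
  have hμ : ∑ x, μ x = 0 := by
    simp [μ, Finset.sum_add_distrib, Finset.sum_sub_distrib]
  let y : Fin N → Matrix (Fin 2) (Fin 2) ℂ := fun x => Matrix.of ![μ x, 0]
  have hy (x) : (y x).det = 0 := by simp [y, Matrix.det_fin_two]
  have hs : ∑ x, y x = 0 := by
    ext r c
    have := congrFun hμ c
    simp only [Finset.sum_apply] at this
    fin_cases r <;> simp [y, Matrix.sum_apply, this]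
  refine ⟨momentaLift y hy hs, ?_, fun h => ?_⟩
  · rw [minorsPlus_pair_le_iff]
    intro c c'
    rw [RingHom.mem_ker, map_sub, map_mul, map_mul]
    simp [y]
  · have := minorsMinus_pair_le_iff.1 h 0 0
    rw [RingHom.mem_ker, map_sub, map_mul, map_mul] at this
    simp only [momentaLift_momentum, y, Matrix.of_apply, Matrix.cons_val_zero, hμi, hμj] at this
    norm_num at this

theorem minorsMinus_pair_not_le_minorsPlus (hN : 3 ≤ N) {i j : Fin N} (hij : i ≠ j) :
    ¬ minorsMinus {i, j} ≤ minorsPlus {i, j} := by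
  obtain ⟨e, h₁, h₂⟩ := exists_point_minorsPlus_pair hN hij
  exact fun h => h₂ (h.trans h₁)

theorem minorsPlus_pair_not_le_minorsMinus (hN : 3 ≤ N) {i j : Fin N} (hij : i ≠ j) :
    ¬ minorsPlus {i, j} ≤ minorsMinus {i, j} := by
  rw [minorsPlus_eq_comap, comap_transposition_le_iff, ← minorsPlus_eq_comap]
  exact minorsMinus_pair_not_le_minorsPlus hN hij

theorem minimalPrimes_idealQ_pair (hN : 5 ≤ N) {i j : Fin N} (hij : i ≠ j) :
    (idealQ {i, j}).minimalPrimes = {minorsPlus {i, j}, minorsMinus {i, j}} := by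
  have hp := minorsPlus_pair_isPrime hN hij
  refine minimalPrimes_eq_of_antichain ?_ ?_ ?_ ?_
  · rintro p (rfl | rfl)
    · exact hp
    · exact minorsMinus_isPrime hp
  · rintro p (rfl | rfl)
    · exact idealQ_pair_le_minorsPlus hij
    · exact idealQ_pair_le_minorsMinus hij
  · intro q hq h
    rcases minorsPlus_le_or_minorsMinus_le hij hq h with h | h <;> exact ⟨_, by simp, h⟩
  · rintro p (rfl | rfl) q (rfl | rfl) h
    · rfl
    · exact absurd h (minorsPlus_pair_not_le_minorsMinus (by omega) hij)
    · exact absurd h (minorsMinus_pair_not_le_minorsPlus (by omega) hij)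
    · rfl

/-- A diagonal point at which the first diagonal entry of `k_J` vanishes lies on every component
of the locus `Q_J = 0`. -/
theorem le_ker_diagonalPoint (hN : 5 ≤ N) {J : Finset (Fin N)} (hJ : IsInternal J)
    {α β : Fin N → ℂ} {hαβ : ∀ i, α i * β i = 0} {hα : ∑ i, α i = 0} {hβ : ∑ i, β i = 0}
    (hαJ : ∑ i ∈ J, α i = 0) {p : Ideal (MomentaRing N)} (hp : p ∈ (idealQ J).minimalPrimes) :
    p ≤ RingHom.ker (diagonalPoint α β hαβ hα hβ) := by
  have hpair {T : Finset (Fin N)} (hT : T.card = 2) (hαT : ∑ i ∈ T, α i = 0)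
      (hp : p ∈ (idealQ T).minimalPrimes) :
      p ≤ RingHom.ker (diagonalPoint α β hαβ hα hβ) := by
    obtain ⟨i, j, hij, rfl⟩ := Finset.card_eq_two.1 hT
    rw [minimalPrimes_idealQ_pair hN hij] at hp
    rcases hp with rfl | rfl
    · exact (minors_pair_le_ker_diagonalPoint hij hαT).1
    · exact (minors_pair_le_ker_diagonalPoint hij hαT).2
  have hαJ' : ∑ i ∈ Jᶜ, α i = 0 := by
    rw [← Finset.sum_add_sum_compl J, hαJ, zero_add] at hα
    exact hα
  have hcard : J.card + Jᶜ.card = N := by rw [Finset.card_add_card_compl, Fintype.card_fin]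
  obtain ⟨h₁, h₂⟩ := hJ
  by_cases h3 : J.card = 2
  · exact hpair h3 hαJ hp
  by_cases h3' : Jᶜ.card = 2
  · rw [← idealQ_compl] at hp
    exact hpair h3' hαJ' hp
  have hprime := idealQ_isPrime (J := J) (by omega) (by omega)
  refine (hp.2 ⟨hprime, le_rfl⟩ hp.1.2).trans ?_
  rw [idealQ, Ideal.span_singleton_le_iff_mem, RingHom.mem_ker, diagonalPoint_Q, hαJ, zero_mul]

/-- If `K` is neither `J` nor its complement, then `J` or its complement meets both `K` and `Kᶜ`. -/
theorem exists_mem_notMem_iff {ι : Type*} [Fintype ι] [DecidableEq ι] {J K : Finset ι}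
    (hK : K.Nonempty) (hK' : Kᶜ.Nonempty) (h : K ≠ J) (h' : K ≠ Jᶜ) :
    ∃ p ∈ K, ∃ q ∉ K, (p ∈ J ↔ q ∈ J) := by
  by_contra! hcon
  obtain ⟨p₀, hp₀⟩ := hK
  obtain ⟨q₀, hq₀⟩ := hK'
  rw [Finset.mem_compl] at hq₀
  by_cases hp : p₀ ∈ J
  · refine h (Finset.ext fun x => ?_)
    have h₁ := hcon p₀ hp₀ x
    have h₂ := (hcon x · q₀ hq₀)
    have h₃ := hcon p₀ hp₀ q₀ hq₀
    tauto
  · refine h' (Finset.ext fun x => ?_)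
    have h₁ := hcon p₀ hp₀ x
    have h₂ := (hcon x · q₀ hq₀)
    have h₃ := hcon p₀ hp₀ q₀ hq₀
    rw [Finset.mem_compl]
    tauto

/-- A component of `Q_J = 0` is contained in `Q_K = 0` only if `K` is `J` or its complement:
otherwise there is a point `diag (e_p - e_q, e_r - e_s)` on every component of `Q_J = 0` at which
`Q_K` equals `1`. -/
theorem eq_or_eq_compl_of_idealQ_le (hN : 5 ≤ N) {J K : Finset (Fin N)} (hJ : IsInternal J)
    (hK : IsInternal K) {p : Ideal (MomentaRing N)} (hp : p ∈ (idealQ J).minimalPrimes)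
    (hle : idealQ K ≤ p) : K = J ∨ K = Jᶜ := by
  by_contra! hne
  have hcard : K.card + Kᶜ.card = N := by rw [Finset.card_add_card_compl, Fintype.card_fin]
  obtain ⟨h₁, h₂⟩ := hK
  obtain ⟨a, ha, b, hb, hab⟩ := exists_mem_notMem_iff (Finset.card_pos.1 (by omega))
    (Finset.card_pos.1 (by omega)) hne.1 hne.2
  obtain ⟨r, hr, hra⟩ := Finset.exists_mem_ne (s := K) (by omega) a
  obtain ⟨s, hs, hsb⟩ := Finset.exists_mem_ne (s := Kᶜ) (by omega) b
  rw [Finset.mem_compl] at hs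
  have hsum (T : Finset (Fin N)) (u v : Fin N) :
      ∑ x ∈ T, (Pi.single u 1 - Pi.single v 1 : Fin N → ℂ) x =
        (if u ∈ T then 1 else 0) - if v ∈ T then 1 else 0 := by
    simp [Finset.sum_sub_distrib, Pi.single_apply]
  have hαβ (x : Fin N) : (Pi.single a 1 - Pi.single b 1 : Fin N → ℂ) x *
      (Pi.single r 1 - Pi.single s 1 : Fin N → ℂ) x = 0 := by
    have has : a ≠ s := fun h => hs (h ▸ ha)
    have hbr : b ≠ r := fun h => hb (h ▸ hr)
    by_cases hxa : x = a
    · rw [hxa]; simp [hra.symm, has]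
    by_cases hxb : x = b
    · rw [hxb]; simp [hsb.symm, hbr]
    simp [hxa, hxb]
  have hker := hle.trans (le_ker_diagonalPoint hN hJ (hαβ := hαβ)
    (hα := by rw [hsum]; simp) (hβ := by rw [hsum]; simp) (by rw [hsum]; simp [hab]) hp)
  rw [idealQ, Ideal.span_singleton_le_iff_mem, RingHom.mem_ker, diagonalPoint_Q, hsum, hsum] at hker
  simp [ha, hb, hr, hs] at hker

theorem existsUnique_idealQ_le (hN : 5 ≤ N) {p : Ideal (MomentaRing N)} (hp : p ∈ primeDivisors N) :
    (∃! 𝔞 : Ideal (MomentaRing N),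
      (∃ J : Finset (Fin N), IsInternal J ∧ 𝔞 = idealQ J) ∧ 𝔞 ≤ p) ∧
    ∀ J K : Finset (Fin N), IsInternal J → IsInternal K →
      idealQ J ≤ p → idealQ K ≤ p → K = J ∨ K = Jᶜ := by
  obtain ⟨J₀, hJ₀, hp⟩ := hp
  constructor
  · refine ⟨idealQ J₀, ⟨⟨J₀, hJ₀, rfl⟩, hp.1.2⟩, ?_⟩
    rintro _ ⟨⟨K, hK, rfl⟩, hle⟩
    rcases eq_or_eq_compl_of_idealQ_le hN hJ₀ hK hp hle with rfl | rfl
    · rfl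
    · exact idealQ_compl J₀
  · intro J K hJ hK hJp hKp
    rcases eq_or_eq_compl_of_idealQ_le hN hJ₀ hJ hp hJp with rfl | rfl <;>
      rcases eq_or_eq_compl_of_idealQ_le hN hJ₀ hK hp hKp with rfl | rfl <;> simp

end Separation

end MomentaVariety

end

theorem mainTheorem6 :
    -- the case `N = 4`: the complete list of the eight prime divisors, and what they are
    -- minimal over
    ((MomentaVariety.primeDivisors 4).ncard = 8 ∧
      MomentaVariety.primeDivisors 4 =
        {MomentaVariety.minorsPlus Finset.univ, MomentaVariety.minorsMinus Finset.univ} ∪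
          {p | ∃ S : Finset (Fin 4), S.card = 2 ∧ p = MomentaVariety.mixedIdeal S} ∧
      (∀ J : Finset (Fin 4), MomentaVariety.IsInternal J →
        MomentaVariety.minorsPlus Finset.univ ∈ (MomentaVariety.idealQ J).minimalPrimes ∧
        MomentaVariety.minorsMinus Finset.univ ∈ (MomentaVariety.idealQ J).minimalPrimes) ∧
      (∀ S : Finset (Fin 4), S.card = 2 →
        MomentaVariety.idealQ S = MomentaVariety.idealQ Sᶜ ∧
        ∀ J : Finset (Fin 4), MomentaVariety.IsInternal J →
          (MomentaVariety.mixedIdeal S ∈ (MomentaVariety.idealQ J).minimalPrimes ↔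
            J = S ∨ J = Sᶜ)) ∧
      MomentaVariety.zeroLocus (MomentaVariety.minorsPlus (Finset.univ : Finset (Fin 4))) =
        {x | ∃ (v : Fin 2 → ℂ) (w : Fin 4 → Fin 2 → ℂ),
          ∑ i, w i = 0 ∧ ∀ i, x i = Matrix.vecMulVec v (w i)}) ∧
    -- the case `N ≥ 5`
    (∀ N : ℕ, 5 ≤ N →
      -- every prime divisor lies over a unique `(Q_J)`, with `J` unique up to complement
      (∀ p ∈ MomentaVariety.primeDivisors N,
        (∃! 𝔞 : Ideal (MomentaVariety.MomentaRing N),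
          (∃ J : Finset (Fin N), MomentaVariety.IsInternal J ∧ 𝔞 = MomentaVariety.idealQ J) ∧
            𝔞 ≤ p) ∧
        ∀ J K : Finset (Fin N), MomentaVariety.IsInternal J → MomentaVariety.IsInternal K →
          MomentaVariety.idealQ J ≤ p → MomentaVariety.idealQ K ≤ p → K = J ∨ K = Jᶜ) ∧
      (∀ J : Finset (Fin N), 3 ≤ J.card → 3 ≤ Jᶜ.card → (MomentaVariety.idealQ J).IsPrime) ∧
      (∀ i j : Fin N, i ≠ j →
        (MomentaVariety.idealQ {i, j}).minimalPrimes =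
          {MomentaVariety.minorsPlus {i, j}, MomentaVariety.minorsMinus {i, j}} ∧
        MomentaVariety.minorsPlus {i, j} ≠ MomentaVariety.minorsMinus {i, j})) := by

  refine ⟨⟨?_, ?_, fun J hJ => ?_, fun S hS => ⟨?_, fun J hJ => ?_⟩, ?_⟩, fun N hN =>
    ⟨fun p hp => ?_, fun J hJ hJ' => ?_, fun i j hij => ⟨?_, fun h => ?_⟩⟩⟩
  · rw [MomentaVariety.primeDivisors_four]
    exact MomentaVariety.ncard_fourPrimes
  · exact MomentaVariety.primeDivisors_four
  · rw [MomentaVariety.minimalPrimes_idealQ_four (MomentaVariety.isInternal_four_iff.1 hJ)]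
    simp
  · exact (MomentaVariety.idealQ_compl S).symm
  · exact MomentaVariety.mixedIdeal_mem_minimalPrimes_iff hS
      (MomentaVariety.isInternal_four_iff.1 hJ)
  · exact MomentaVariety.zeroLocus_minorsPlus_univ
  · exact MomentaVariety.existsUnique_idealQ_le hN hp
  · exact MomentaVariety.idealQ_isPrime hJ hJ'
  · exact MomentaVariety.minimalPrimes_idealQ_pair hN hij
  · exact MomentaVariety.minorsPlus_pair_not_le_minorsMinus (by omega) hij h.le
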